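/- Let $N$ be a natural number, let $\mathbb{W}^N=\{x\in\mathbb{Z}^N: x_1<\dots<x_N\}$, and $\mathsf V(x)=\prod_{j<i}(x_i-x_j)$. The noncolliding Poisson random walk is the continuous time Markov chain $X(\tau)$, $\tau\ge 0$, on $\mathbb{W}^N$ with jump rates $$q(x,x')=\begin{cases}\mathsf V(x')/\mathsf V(x), & x'=x+e_i \text{ for some } i,\\ -N, & x'=x,\\ 0,&\text{otherwise,}\end{cases}$$ where $e_i$ is the $i$-th basis vector; that is, its transition probabilities satisfy $p_h(x,x')=\mathbf 1_{x=x'}+q(x,x')h+o(h)$ as $h\downarrow0$. **Theorem.** Let $a\in\mathbb{W}^N$ be arbitrary. The noncolliding Poisson random walk $X(\tau)$ started from $X(0)=a$ is determinantal: for every $k$ and all pairwise distinct space-time points $(\tau_i,y_i)\in\mathbb{R}_{>0}\times\mathbb{Z}$, $i=1,\dots,k$, $$\mathbb{P}\big(\text{the configuration } X(\tau_i) \text{ contains the point } y_i \text{ for all } i=1,\dots,k\big)=\det\big[K^{\mathrm{Poisson}}_a(\tau_\alpha,y_\alpha;\tau_\beta,y_\beta)\big]_{\alpha,\beta=1}^k,$$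 where for $x_1,x_2\in\mathbb{Z}$ and $\tau_1,\tau_2>0$ $$K^{\mathrm{Poisson}}_a(\tau_1,x_1;\tau_2,x_2)=-\mathbf 1_{x_1\ge x_2}\mathbf 1_{\tau_1>\tau_2}\frac{(\tau_1-\tau_2)^{x_1-x_2}}{(x_1-x_2)!}-\frac{1}{(2\pi \mathrm i)^2}\int_{x_2-\frac12-\mathrm i\infty}^{x_2-\frac12+\mathrm i\infty}dz\oint dw\,\frac{1}{w-z}\,\frac{\Gamma(x_2-z)}{\Gamma(x_1-w+1)}\,\tau_1^{x_1-w}\tau_2^{z-x_2}\prod_{r=1}^N\frac{z-a_r}{w-a_r}.$$ The $z$ contour is the vertical line $\Re z=x_2-\frac12$ traversed upwards, and the integral over it converges absolutely; the $w$ contour is any positively oriented circle, or union of two circles on the two sides of this line, which does not meet the line, passes through no integer, and encircles all the points of $\{\dots,x_1-1,x_1\}\cap\{a_1,\dots,a_N\}$. Moreover, for all $x_1,x_2\in\mathbb{Z}$ and $\tau_1,\tau_2>0$, $$\lim_{\beta\downarrow0}(-\beta)^{x_1-x_2}K^{\mathrm{Bernoulli}}_{a;\beta}\big(\lfloor\beta^{-1}\tau_1\rfloor,x_1;\lfloor\beta^{-1}\tau_2\rfloor,x_2\big)=K^{\mathrm{Poisson}}_a(\tau_1,x_1;\tau_2,x_2),$$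 where for $\beta\in(0,1)$ and integers $t_1,t_2\ge1$ the kernel $K^{\mathrm{Bernoulli}}_{a;\beta}$ of the noncolliding Bernoulli random walk is $$K^{\mathrm{Bernoulli}}_{a;\beta}(t_1,x_1;t_2,x_2)=\mathbf 1_{x_1\ge x_2}\mathbf 1_{t_1>t_2}(-1)^{x_1-x_2+1}\binom{t_1-t_2}{x_1-x_2}+\frac{t_1!}{(t_2-1)!}\frac{1}{(2\pi \mathrm i)^2}\int_{x_2-t_2+\frac12-\mathrm i\infty}^{x_2-t_2+\frac12+\mathrm i\infty}dz\oint dw\,\frac{(z-x_2+1)_{t_2-1}}{(w-x_1)_{t_1+1}}\,\frac{1}{w-z}\,\frac{\sin(\pi w)}{\sin(\pi z)}\Big(\frac{1-\beta}{\beta}\Big)^{w-z}\prod_{r=1}^N\frac{z-a_r}{w-a_r},$$ with $(u)_k=u(u+1)\cdots(u+k-1)$, the $z$ contour the line $\Re z=x_2-t_2+\frac12$ traversed upwards, and the $w$ contour any positively oriented circle, or union of two circles on the two sides of this line, which does not meet the line, passes through no integer, and encircles all the points of $\{x_1-t_1,\dots,x_1\}\cap\{a_1,\dots,a_N\}$.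 -/

import Mathlib

open MeasureTheory Filter Topology
open scoped NNReal Nat

noncomputable section

namespace NoncollidingWalk

/-- The Weyl chamber: strictly increasing integer vectors `x₁ < ⋯ < x_N`. -/
abbrev Weyl (N : ℕ) : Type := {x : Fin N → ℤ // StrictMono x}

/-- The Vandermonde product `∏_{j < i} (x_i - x_j)`. -/
def vandermonde {N : ℕ} (x : Weyl N) : ℝ :=
  ∏ i, ∏ j ∈ Finset.Iio i, ((x.1 i : ℝ) - (x.1 j : ℝ))

/-- Jump rates of the noncolliding Poisson random walk (with the diagonal entry `-N`). -/
def poissonRate {N : ℕ} (x y : Weyl N) : ℝ :=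
  if ∃ i, y.1 = Function.update x.1 i (x.1 i + 1) then vandermonde y / vandermonde x
  else if y = x then -(N : ℝ)
  else 0

/-- Transition function of a continuous time (honest, time homogeneous) Markov chain
on a discrete state space `S`. -/
structure IsTransitionFunction {S : Type*} (p : ℝ≥0 → S → S → ℝ) : Prop where
  nonneg : ∀ t x y, 0 ≤ p t x y
  hasSum_one : ∀ t x, HasSum (fun y => p t x y) 1
  zero_self : ∀ x, p 0 x x = 1
  chapman_kolmogorov : ∀ s t x z, HasSum (fun y => p s x y * p t y z) (p (s + t) x z)

/-- `p` has jump rates `q`: as `h ↓ 0`, `p h x y = δ_{x,y} + q x y * h + o(h)`. -/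
def HasJumpRates {S : Type*} (p : ℝ≥0 → S → S → ℝ) (q : S → S → ℝ) : Prop :=
  ∀ x y, Tendsto (fun h : ℝ≥0 => (p h x y - p 0 x y) / (h : ℝ)) (𝓝[>] 0) (𝓝 (q x y))

/-- `X` is a Markov chain with transition function `p`, started from `a`. -/
structure IsMarkovChain {Ω S : Type*} [MeasurableSpace Ω] (μ : Measure Ω)
    (X : ℝ≥0 → Ω → S) (p : ℝ≥0 → S → S → ℝ) (a : S) : Prop where
  measurableSet : ∀ t x, MeasurableSet {ω | X t ω = x}
  start : ∀ᵐ ω ∂μ, X 0 ω = a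
  markov : ∀ (n : ℕ) (t : Fin (n + 1) → ℝ≥0), Monotone t → ∀ (x : Fin (n + 1) → S)
    (s : ℝ≥0) (y : S),
    μ.real {ω | (∀ i, X (t i) ω = x i) ∧ X (t (Fin.last n) + s) ω = y} =
      μ.real {ω | ∀ i, X (t i) ω = x i} * p s (x (Fin.last n)) y

/-- `X` is a noncolliding Poisson random walk started from `a`. -/
def IsNoncollidingPoissonWalk {N : ℕ} {Ω : Type*} [MeasurableSpace Ω] (μ : Measure Ω)
    (X : ℝ≥0 → Ω → Weyl N) (a : Weyl N) : Prop :=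
  ∃ p : ℝ≥0 → Weyl N → Weyl N → ℝ,
    IsTransitionFunction p ∧ HasJumpRates p poissonRate ∧ IsMarkovChain μ X p a

/-- The space-time correlations of `X` at positive times are determinants of the kernel `K`:
for pairwise distinct space-time points `(τ_i, y_i)`, `τ_i > 0`, the probability that the
configuration `X (τ_i)` contains `y_i` for all `i` is `det [K(τ_α, y_α; τ_β, y_β)]`. -/
def IsDeterminantal {N : ℕ} {Ω : Type*} [MeasurableSpace Ω] (μ : Measure Ω)
    (X : ℝ≥0 → Ω → Weyl N) (K : ℝ → ℤ → ℝ → ℤ → ℂ) : Prop :=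
  ∀ (k : ℕ) (τ : Fin k → ℝ≥0) (y : Fin k → ℤ), (∀ i, 0 < τ i) →
    Function.Injective (fun i => (τ i, y i)) →
    ((μ.real {ω | ∀ i, ∃ j, (X (τ i) ω).1 j = y i} : ℝ) : ℂ) =
      (Matrix.of fun α β => K (τ α) (y α) (τ β) (y β)).det

/-- A `w` contour for a `z` integral over the line `Re z = σ`: two positively oriented circles,
one on each side of the line (so that `w = z` is not encircled), which together encircle all
the points of `P`. A circle of radius `0` contributes nothing, which covers the case of a
single circle. The points where the integrands below are undefined are integers, and the
circles pass through none of them. -/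
structure WContour (σ : ℝ) (P : Set ℤ) where
  cL : ℂ
  rL : ℝ
  cR : ℂ
  rR : ℝ
  rL_nonneg : 0 ≤ rL
  rR_nonneg : 0 ≤ rR
  left_of_line : cL.re + rL < σ
  right_of_line : σ < cR.re - rR
  encircles : ∀ n ∈ P, dist (n : ℂ) cL < rL ∨ dist (n : ℂ) cR < rR
  avoids_left : ∀ n : ℤ, dist (n : ℂ) cL ≠ rL
  avoids_right : ∀ n : ℤ, dist (n : ℂ) cR ≠ rR

/-- The contour integral `∮ f(w) dw` over the two circles. -/
def WContour.integral {σ : ℝ} {P : Set ℤ} (C : WContour σ P) (f : ℂ → ℂ) : ℂ :=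
  circleIntegral f C.cL C.rL + circleIntegral f C.cR C.rR

/-- The integral `∫ f(z) dz` over the line `Re z = σ` traversed upwards. -/
def lineIntegral (σ : ℝ) (f : ℂ → ℂ) : ℂ :=
  Complex.I * ∫ y : ℝ, f ((σ : ℂ) + (y : ℂ) * Complex.I)

/-- The `w` poles `{…, x₁ - 1, x₁} ∩ {a₁, …, a_N}` in the Poisson case. -/
def poissonPoles {N : ℕ} (a : Weyl N) (x₁ : ℤ) : Set ℤ :=
  Set.Iic x₁ ∩ Set.range a.1

/-- The contours admitted in the Poisson kernel. -/
abbrev PoissonContour {N : ℕ} (a : Weyl N) (x₁ x₂ : ℤ) : Type :=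
  WContour ((x₂ : ℝ) - 1 / 2) (poissonPoles a x₁)

/-- The inner (`w`) integral in the Poisson kernel, as a function of `z`. -/
def poissonInner {N : ℕ} (a : Weyl N) {x₁ x₂ : ℤ} (C : PoissonContour a x₁ x₂)
    (τ₁ τ₂ : ℝ) (z : ℂ) : ℂ :=
  C.integral fun w =>
    1 / (w - z) * (Complex.Gamma (x₂ - z) / Complex.Gamma (x₁ - w + 1)) *
      (τ₁ : ℂ) ^ ((x₁ : ℂ) - w) * (τ₂ : ℂ) ^ (z - (x₂ : ℂ)) *
      ∏ r, (z - (a.1 r : ℂ)) / (w - (a.1 r : ℂ))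

/-- The kernel `K^Poisson_a(τ₁, x₁; τ₂, x₂)`. -/
def poissonKernel {N : ℕ} (a : Weyl N) (C : ∀ x₁ x₂ : ℤ, PoissonContour a x₁ x₂)
    (τ₁ : ℝ) (x₁ : ℤ) (τ₂ : ℝ) (x₂ : ℤ) : ℂ :=
  -(if x₂ ≤ x₁ ∧ τ₂ < τ₁ then
      ((τ₁ : ℂ) - τ₂) ^ (x₁ - x₂).toNat / ((x₁ - x₂).toNat ! : ℂ) else 0)
  - 1 / (2 * Real.pi * Complex.I) ^ 2 *
      lineIntegral ((x₂ : ℝ) - 1 / 2) (poissonInner a (C x₁ x₂) τ₁ τ₂)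

/-- The `w` poles `{x₁ - t₁, …, x₁} ∩ {a₁, …, a_N}` in the Bernoulli case. -/
def bernoulliPoles {N : ℕ} (a : Weyl N) (t₁ : ℕ) (x₁ : ℤ) : Set ℤ :=
  Set.Icc (x₁ - t₁) x₁ ∩ Set.range a.1

/-- The contours admitted in the Bernoulli kernel. -/
abbrev BernoulliContour {N : ℕ} (a : Weyl N) (t₁ : ℕ) (x₁ : ℤ) (t₂ : ℕ) (x₂ : ℤ) : Type :=
  WContour ((x₂ : ℝ) - (t₂ : ℝ) + 1 / 2) (bernoulliPoles a t₁ x₁)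

/-- The inner (`w`) integral in the Bernoulli kernel, as a function of `z`. -/
def bernoulliInner {N : ℕ} (a : Weyl N) (β : ℝ) {t₁ : ℕ} {x₁ : ℤ} {t₂ : ℕ} {x₂ : ℤ}
    (C : BernoulliContour a t₁ x₁ t₂ x₂) (z : ℂ) : ℂ :=
  C.integral fun w =>
    (ascPochhammer ℂ (t₂ - 1)).eval (z - x₂ + 1) / (ascPochhammer ℂ (t₁ + 1)).eval (w - x₁) *
      (1 / (w - z)) * (Complex.sin (Real.pi * w) / Complex.sin (Real.pi * z)) *
      (((1 - β) / β : ℝ) : ℂ) ^ (w - z) *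
      ∏ r, (z - (a.1 r : ℂ)) / (w - (a.1 r : ℂ))

/-- The kernel `K^Bernoulli_{a;β}(t₁, x₁; t₂, x₂)` of the noncolliding Bernoulli random walk
(meaningful for `t₁, t₂ ≥ 1` and `0 < β < 1`). -/
def bernoulliKernel {N : ℕ} (a : Weyl N)
    (C : ∀ (t₁ : ℕ) (x₁ : ℤ) (t₂ : ℕ) (x₂ : ℤ), BernoulliContour a t₁ x₁ t₂ x₂) (β : ℝ)
    (t₁ : ℕ) (x₁ : ℤ) (t₂ : ℕ) (x₂ : ℤ) : ℂ :=
  (if x₂ ≤ x₁ ∧ t₂ < t₁ then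
      (-1) ^ ((x₁ - x₂).toNat + 1) * ((t₁ - t₂).choose (x₁ - x₂).toNat : ℂ) else 0)
  + (t₁ ! : ℂ) / ((t₂ - 1)! : ℂ) * (1 / (2 * Real.pi * Complex.I) ^ 2) *
      lineIntegral ((x₂ : ℝ) - (t₂ : ℝ) + 1 / 2) (bernoulliInner a β (C t₁ x₁ t₂ x₂))

/-- Contours exist for every line between two consecutive integers and every finite `P`. -/
theorem nonempty_wContour (m : ℤ) {P : Set ℤ} (hP : P.Finite) {σ : ℝ}
    (hσ : σ = (m : ℝ) - 1 / 2) : Nonempty (WContour σ P) := by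
  obtain ⟨u, hu⟩ := hP.bddAbove
  obtain ⟨l, hl⟩ := hP.bddBelow
  set R : ℤ := |u - m| + |l - m| + 1 with hR
  have hR0 : 0 ≤ R := by positivity
  have key : ∀ (n : ℤ) (c : ℝ), dist (n : ℂ) (c : ℂ) = |(n : ℝ) - c| := by
    intro n c
    rw [Complex.dist_eq, ← Complex.ofReal_intCast, ← Complex.ofReal_sub, Complex.norm_real,
      Real.norm_eq_abs]
  have hR0' : (0 : ℝ) ≤ R := by exact_mod_cast hR0
  refine ⟨⟨((m - 3 / 4 - R : ℝ) : ℂ), R, ((m - 1 / 4 + R : ℝ) : ℂ), R, hR0', hR0',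
    ?_, ?_, ?_, ?_, ?_⟩⟩
  · rw [hσ, Complex.ofReal_re]; linarith
  · rw [hσ, Complex.ofReal_re]; linarith
  · intro n hn
    have h1 : n ≤ m + R - 1 := by
      have := hu hn; have := le_abs_self (u - m); have := abs_nonneg (l - m); omega
    have h2 : m - R + 1 ≤ n := by
      have := hl hn; have := neg_abs_le (l - m); have := abs_nonneg (u - m); omega
    have h1' : (n : ℝ) ≤ m + R - 1 := by exact_mod_cast h1
    have h2' : (m : ℝ) - R + 1 ≤ n := by exact_mod_cast h2
    rw [key, key]
    rcases lt_or_ge n m with h | h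
    · have h' : (n : ℝ) + 1 ≤ m := by exact_mod_cast h
      left; rw [abs_lt]; constructor <;> linarith
    · have h' : (m : ℝ) ≤ n := by exact_mod_cast h
      right; rw [abs_lt]; constructor <;> linarith
  · intro n h
    rw [key] at h
    rcases (abs_eq hR0').1 h with h | h
    · have : (4 * n : ℝ) = 4 * m - 3 := by linarith
      have : 4 * n = 4 * m - 3 := by exact_mod_cast this
      omega
    · have : (4 * n : ℝ) = 4 * m - 3 - 8 * R := by linarith
      have : 4 * n = 4 * m - 3 - 8 * R := by exact_mod_cast this
      omega
  · intro n h
    rw [key] at h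
    rcases (abs_eq hR0').1 h with h | h
    · have : (4 * n : ℝ) = 4 * m - 1 + 8 * R := by linarith
      have : 4 * n = 4 * m - 1 + 8 * R := by exact_mod_cast this
      omega
    · have : (4 * n : ℝ) = 4 * m - 1 := by linarith
      have : 4 * n = 4 * m - 1 := by exact_mod_cast this
      omega

theorem nonempty_poissonContour {N : ℕ} (a : Weyl N) (x₁ x₂ : ℤ) :
    Nonempty (PoissonContour a x₁ x₂) :=
  nonempty_wContour x₂ ((Set.finite_range a.1).inter_of_right _) rfl

theorem nonempty_bernoulliContour {N : ℕ} (a : Weyl N) (t₁ : ℕ) (x₁ : ℤ) (t₂ : ℕ) (x₂ : ℤ) :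
    Nonempty (BernoulliContour a t₁ x₁ t₂ x₂) :=
  nonempty_wContour (x₂ - t₂ + 1) ((Set.finite_range a.1).inter_of_right _)
    (by push_cast; ring)

end NoncollidingWalk

end

/-!
A contour integral over two circles is a sum of residues. The residues of the Poisson kernel leave
Mellin–Barnes integrals of `Γ` times a polynomial, which Mellin inversion evaluates: the kernel is
`-1_{τ₂ < τ₁} w_{τ₁ - τ₂}(x₁ - x₂) + ∑ r, w_{τ₁}(x₁ - a_r) (exp(-τ₂ S) L_r)(x₂)`, where
`w_t(n) = t ^ n / n!`, `S` is the shift and `L_r` are the Lagrange polynomials at the nodes `a_r`.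
The residues of the Bernoulli kernel leave in the same way integrals of beta functions, and its
limit is taken term by term.

The jump rates determine the transition function, since a bounded solution of the backward equation
with bounded rates is unique: it is the Vandermonde transform of the Karlin–McGregor determinant
`det [w_t(z_j - x_i)]`. The expectation of `∏ i, (1 + u 1_{y_i ∈ X(τ_i)})` can therefore be computed
backward in time, one time at a time, by the Cauchy–Binet formula, starting from the Lagrange
polynomials. The result is `det (1 + u K)`, whose leading coefficient in `u` is the correlation
probability.
-/

namespace NoncollidingWalk

open scoped Polynomial

section MellinInversion

theorem verticalIntegrable_congr {E : Type*} [NormedAddCommGroup E] {f g : ℂ → E} {σ : ℝ}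
    (h : ∀ s : ℂ, s.re = σ → f s = g s) :
    Complex.VerticalIntegrable f σ ↔ Complex.VerticalIntegrable g σ :=
  integrable_congr (Eventually.of_forall fun y => h _ (by simp))

theorem verticalIntegrable_reflect_iff {E : Type*} [NormedAddCommGroup E] {f : ℂ → E}
    (c σ : ℝ) : Complex.VerticalIntegrable f (c - σ) ↔
      Complex.VerticalIntegrable (fun u => f (c - u)) σ := by
  unfold Complex.VerticalIntegrable
  rw [← integrable_comp_mul_left_iff _ (neg_ne_zero.2 (one_ne_zero (α := ℝ)))]
  refine integrable_congr (Eventually.of_forall fun y => congrArg f ?_)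
  push_cast
  ring

variable {E : Type*} [NormedAddCommGroup E] [NormedSpace ℂ E]

theorem verticalIntegrable_cpow_neg_smul {f : ℂ → E} {σ x : ℝ}
    (hf : Complex.VerticalIntegrable f σ) (hx : 0 < x) :
    Complex.VerticalIntegrable (fun s => (x : ℂ) ^ (-s) • f s) σ := by
  have hx0 : (x : ℂ) ≠ 0 := Complex.ofReal_ne_zero.2 hx.ne'
  refine Integrable.bdd_smul (C := x ^ (-σ)) hf
    (Continuous.const_cpow (by fun_prop) (Or.inl hx0)).aestronglyMeasurable
    (Eventually.of_forall fun y => ?_)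
  simp [Complex.norm_cpow_eq_rpow_re_of_pos hx]

theorem mellinInv_add {f g : ℂ → E} {σ x : ℝ} (hf : Complex.VerticalIntegrable f σ)
    (hg : Complex.VerticalIntegrable g σ) (hx : 0 < x) :
    mellinInv σ (fun s => f s + g s) x = mellinInv σ f x + mellinInv σ g x := by
  simp only [mellinInv, smul_add]
  rw [integral_add (verticalIntegrable_cpow_neg_smul hf hx)
    (verticalIntegrable_cpow_neg_smul hg hx), smul_add]

theorem mellinInv_const_smul (f : ℂ → E) (c : ℂ) (σ x : ℝ) :
    mellinInv σ (fun s => c • f s) x = c • mellinInv σ f x := by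
  simp only [mellinInv, smul_comm _ c, integral_smul]

theorem mellinInv_congr {f g : ℂ → E} {σ : ℝ} (h : ∀ s : ℂ, s.re = σ → f s = g s) (x : ℝ) :
    mellinInv σ f x = mellinInv σ g x := by
  have hfg (y : ℝ) : f (σ + y * Complex.I) = g (σ + y * Complex.I) := h _ (by simp)
  simp only [mellinInv, hfg]

theorem mellinInv_comp_add (f : ℂ → E) (a σ : ℝ) {x : ℝ} (hx : 0 < x) :
    mellinInv σ (fun s => f (s + a)) x = (x : ℂ) ^ (a : ℂ) • mellinInv (σ + a) f x := by
  have hx0 : (x : ℂ) ≠ 0 := Complex.ofReal_ne_zero.2 hx.ne'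
  have hshift (y : ℝ) : (x : ℂ) ^ (-(σ + y * Complex.I)) • f (σ + y * Complex.I + a) =
      (x : ℂ) ^ (a : ℂ) • (x : ℂ) ^ (-((σ + a : ℝ) + y * Complex.I)) •
        f ((σ + a : ℝ) + y * Complex.I) := by
    rw [smul_smul, ← Complex.cpow_add _ _ hx0]
    congr 2 <;> push_cast <;> ring
  simp only [mellinInv, hshift, integral_smul]
  rw [smul_comm]

theorem integral_vertical_reflect (f : ℂ → E) (c σ : ℝ) :
    ∫ y : ℝ, f ((c - σ : ℂ) + y * Complex.I) = ∫ y : ℝ, f (c - (σ + y * Complex.I)) := by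
  rw [← integral_neg_eq_self]
  congr! 3
  push_cast
  ring

theorem lineIntegral_cpow_mul_reflect (g : ℂ → ℂ) (c σ x : ℝ) :
    lineIntegral (c - σ) (fun z => (x : ℂ) ^ (z - c) * g (c - z)) =
      2 * Real.pi * Complex.I * mellinInv σ g x := by
  have hπ : (Real.pi : ℂ) ≠ 0 := Complex.ofReal_ne_zero.2 Real.pi_ne_zero
  rw [lineIntegral, Complex.ofReal_sub,
    integral_vertical_reflect (fun z => (x : ℂ) ^ (z - c) * g (c - z)), mellinInv]
  simp only [sub_sub_cancel_left, sub_sub_cancel, smul_eq_mul, Complex.real_smul]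
  push_cast
  field_simp

end MellinInversion

section GammaFunction

theorem norm_Gamma_le {s : ℂ} (hs : 0 < s.re) : ‖Complex.Gamma s‖ ≤ Real.Gamma s.re := by
  rw [Complex.Gamma_eq_integral hs, Real.Gamma_eq_integral hs]
  refine (norm_integral_le_integral_norm _).trans_eq
    (setIntegral_congr_fun measurableSet_Ioi fun x hx => ?_)
  simp [Complex.norm_cpow_eq_rpow_re_of_pos (Set.mem_Ioi.1 hx), Complex.norm_exp]

theorem ne_neg_natCast_of_re_pos {s : ℂ} (hs : 0 < s.re) (m : ℕ) : s ≠ -m := by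
  rintro rfl
  simp only [Complex.neg_re, Complex.natCast_re, Left.neg_pos_iff] at hs
  exact hs.not_ge m.cast_nonneg

theorem Gamma_mul_ascPochhammer_eval {s : ℂ} (hs : ∀ m : ℕ, s ≠ -m) (k : ℕ) :
    Complex.Gamma s * (ascPochhammer ℂ k).eval s = Complex.Gamma (s + k) := by
  rw [← Complex.Gamma_add_nat_div_Gamma_eq s hs,
    mul_div_cancel₀ _ (Complex.Gamma_ne_zero hs)]

theorem continuous_vertical_Gamma {σ : ℝ} (hσ : 0 < σ) :
    Continuous fun y : ℝ => Complex.Gamma (σ + y * Complex.I) :=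
  continuous_iff_continuousAt.2 fun y =>
    (Complex.differentiableAt_Gamma _ (ne_neg_natCast_of_re_pos (by simpa))).continuousAt.comp
      (f := fun y : ℝ => (σ + y * Complex.I : ℂ)) (by fun_prop)

theorem sq_norm_mul_norm_Gamma_le {s : ℂ} (hs : 0 < s.re) :
    ‖s‖ ^ 2 * ‖Complex.Gamma s‖ ≤ Real.Gamma (s.re + 2) := by
  have hfeq : Complex.Gamma (s + 2) = s * (s + 1) * Complex.Gamma s := by
    rw [← Nat.cast_two, ← Gamma_mul_ascPochhammer_eval (ne_neg_natCast_of_re_pos hs)]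
    simp [ascPochhammer_succ_eval, mul_comm]
  have hnorm : ‖s‖ ≤ ‖s + 1‖ := by
    rw [Complex.norm_def, Complex.norm_def, Complex.normSq_apply, Complex.normSq_apply]
    simp only [Complex.add_re, Complex.one_re, Complex.add_im, Complex.one_im, add_zero]
    gcongr <;> linarith
  calc ‖s‖ ^ 2 * ‖Complex.Gamma s‖ ≤ ‖s‖ * ‖s + 1‖ * ‖Complex.Gamma s‖ := by
        rw [sq]
        gcongr
    _ = ‖Complex.Gamma (s + 2)‖ := by rw [hfeq, norm_mul, norm_mul]
    _ ≤ Real.Gamma (s.re + 2) := by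
        simpa using norm_Gamma_le (s := s + 2) (by simpa using by linarith)

theorem verticalIntegrable_Gamma {σ : ℝ} (hσ : 0 < σ) :
    Complex.VerticalIntegrable Complex.Gamma σ := by
  have hbound : Integrable fun y : ℝ => Real.Gamma (σ + 2) * (σ ^ 2)⁻¹ * (1 + (y / σ) ^ 2)⁻¹ :=
    (integrable_inv_one_add_sq.comp_div hσ.ne').const_mul _
  refine hbound.mono' (continuous_vertical_Gamma hσ).aestronglyMeasurable
    (Eventually.of_forall fun y => ?_)
  have hsq : ‖(σ + y * Complex.I : ℂ)‖ ^ 2 = σ ^ 2 * (1 + (y / σ) ^ 2) := by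
    rw [Complex.sq_norm, Complex.normSq_add_mul_I]
    field_simp
  have h := sq_norm_mul_norm_Gamma_le (s := σ + y * Complex.I) (by simpa)
  rw [hsq, ← le_div_iff₀' (by positivity)] at h
  refine h.trans_eq ?_
  simp only [Complex.add_re, Complex.ofReal_re, Complex.re_ofReal_mul, Complex.I_re, mul_zero,
    add_zero]
  rw [div_eq_mul_inv, mul_inv, mul_assoc]

end GammaFunction

section RisingFactorials

theorem ascPochhammer_induction {R : Type*} [CommRing R] [IsDomain R] {p : R[X] → Prop}
    (ascPochhammer : ∀ k, p (ascPochhammer R k)) (zero : p 0)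
    (add : ∀ P Q, p P → p Q → p (P + Q)) (smul : ∀ (c : R) P, p P → p (c • P)) (P : R[X]) :
    p P := by
  let S : Polynomial.Sequence R :=
    { elems' := _root_.ascPochhammer R
      degree_eq' := fun k => by
        rw [Polynomial.degree_eq_natDegree (monic_ascPochhammer R k).ne_zero,
          ascPochhammer_natDegree] }
  have hP : P ∈ Submodule.span R (Set.range S) := by
    rw [S.span fun k => (monic_ascPochhammer R k).leadingCoeff.symm ▸ isUnit_one]
    exact Submodule.mem_top
  induction hP using Submodule.span_induction with
  | mem P hP =>
    obtain ⟨k, rfl⟩ := hP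
    exact ascPochhammer k
  | zero => exact zero
  | add P Q _ _ hP hQ => exact add P Q hP hQ
  | smul c P _ hP => exact smul c P hP

theorem ascPochhammer_eval_neg_natCast_add {R : Type*} [CommRing R] (k m : ℕ) :
    (m ! : R) * (ascPochhammer R k).eval (-((m + k : ℕ) : R)) = (-1) ^ k * (m + k)! := by
  rw [ascPochhammer_eval_neg_eq_descPochhammer, descPochhammer_eval_eq_descFactorial,
    mul_left_comm, ← Nat.cast_mul]
  have h := Nat.factorial_mul_descFactorial (Nat.le_add_left k m)
  rw [Nat.add_sub_cancel] at h
  rw [h]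

theorem verticalIntegrable_Gamma_mul_eval {σ : ℝ} (hσ : 0 < σ) (P : ℂ[X]) :
    Complex.VerticalIntegrable (fun s => Complex.Gamma s * P.eval s) σ := by
  induction P using ascPochhammer_induction with
  | ascPochhammer k =>
    have h := verticalIntegrable_Gamma (σ := σ + k) (by positivity)
    refine Integrable.congr h (Eventually.of_forall fun y => ?_)
    simp only [Gamma_mul_ascPochhammer_eval
      (ne_neg_natCast_of_re_pos (s := σ + y * Complex.I) (by simpa))]
    congr 1
    push_cast
    ring
  | zero => simp [Complex.VerticalIntegrable]
  | add P Q hP hQ =>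
    simpa only [Polynomial.eval_add, mul_add] using! Integrable.add hP hQ
  | smul c P hP =>
    simpa only [Polynomial.eval_smul, smul_eq_mul, mul_left_comm] using! Integrable.const_mul hP c

theorem mellinInv_Gamma {σ τ : ℝ} (hσ : 0 < σ) (hτ : 0 < τ) :
    mellinInv σ Complex.Gamma τ = Complex.exp (-τ) := by
  have hmellin (s : ℂ) (hs : s.re = σ) :
      mellin (fun x : ℝ => ((Real.exp (-x) : ℝ) : ℂ)) s = Complex.Gamma s := by
    rw [Complex.Gamma_eq_integral (hs ▸ hσ), Complex.GammaIntegral_eq_mellin]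
  have hconv : MellinConvergent (fun x : ℝ => ((Real.exp (-x) : ℝ) : ℂ)) σ :=
    (Complex.GammaIntegral_convergent (s := σ) (by simpa)).congr_fun
      (fun x _ => mul_comm _ _) measurableSet_Ioi
  rw [← mellinInv_congr hmellin, mellinInv_mellin_eq σ _ hτ hconv
    ((verticalIntegrable_congr hmellin).2 (verticalIntegrable_Gamma hσ))
    (by fun_prop)]
  push_cast
  rfl

theorem mellinInv_Gamma_mul_ascPochhammer {σ τ : ℝ} (hσ : 0 < σ) (hτ : 0 < τ) (k : ℕ) :
    mellinInv σ (fun s => Complex.Gamma s * (ascPochhammer ℂ k).eval s) τ =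
      τ ^ k * Complex.exp (-τ) := by
  have hshift := mellinInv_comp_add Complex.Gamma k σ hτ
  rw [mellinInv_Gamma (by positivity) hτ] at hshift
  simp only [Complex.ofReal_natCast, Complex.cpow_natCast, smul_eq_mul] at hshift
  rw [← hshift]
  exact mellinInv_congr
    (fun s hs => Gamma_mul_ascPochhammer_eval (ne_neg_natCast_of_re_pos (hs ▸ hσ)) k) τ

theorem summable_pow_div_factorial_mul_pow (t : ℝ) (i : ℕ) :
    Summable fun n : ℕ => t ^ n / n ! * (n : ℝ) ^ i := by
  refine Summable.of_norm_bounded (g := fun n : ℕ => i ! * ((Real.exp 1 * |t|) ^ n / n !))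
    ((Real.summable_pow_div_factorial _).mul_left _) fun n => ?_
  have h := Real.pow_div_factorial_le_exp (n : ℝ) n.cast_nonneg i
  rw [div_le_iff₀' (by positivity)] at h
  rw [norm_mul, norm_div, norm_pow, Real.norm_eq_abs, Real.norm_natCast,
    Real.norm_of_nonneg (by positivity), mul_pow, ← Real.exp_nat_mul, mul_one]
  calc |t| ^ n / n ! * (n : ℝ) ^ i ≤ |t| ^ n / n ! * (i ! * Real.exp n) := by gcongr
    _ = _ := by ring

theorem summable_pow_div_factorial_mul_eval_neg (t : ℝ) (P : ℂ[X]) :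
    Summable fun n : ℕ => ((t : ℂ) ^ n / n !) * P.eval (-n : ℂ) := by
  induction P using Polynomial.induction_on' with
  | add p q hp hq => simpa only [Polynomial.eval_add, mul_add] using hp.add hq
  | monomial i b =>
    refine ((Complex.ofRealCLM.summable
      (summable_pow_div_factorial_mul_pow t i)).mul_left (b * (-1) ^ i)).congr fun n => ?_
    simp only [Complex.ofRealCLM_apply, Polynomial.eval_monomial, neg_pow (n : ℂ)]
    push_cast
    ring

theorem tsum_pow_div_factorial_mul_ascPochhammer (τ : ℝ) (k : ℕ) :
    ∑' n : ℕ, ((-τ : ℝ) : ℂ) ^ n / n ! * (ascPochhammer ℂ k).eval (-n : ℂ) =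
      τ ^ k * Complex.exp (-τ) := by
  have hvanish : ∑ n ∈ Finset.range k,
      ((-τ : ℝ) : ℂ) ^ n / n ! * (ascPochhammer ℂ k).eval (-n : ℂ) = 0 :=
    Finset.sum_eq_zero fun n hn => by
      rw [ascPochhammer_eval_neg_coe_nat_of_lt (Finset.mem_range.1 hn), mul_zero]
  have hterm (m : ℕ) : ((-τ : ℝ) : ℂ) ^ (m + k) / (m + k)! *
      (ascPochhammer ℂ k).eval (-((m + k : ℕ) : ℂ)) = τ ^ k * ((-τ : ℂ) ^ m / m !) := by
    have hm : (m ! : ℂ) ≠ 0 := Nat.cast_ne_zero.2 m.factorial_ne_zero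
    have hmk : ((m + k)! : ℂ) ≠ 0 := Nat.cast_ne_zero.2 (m + k).factorial_ne_zero
    have hsign : (-1 : ℂ) ^ k * (-1) ^ k = 1 := by rw [← mul_pow, neg_mul_neg, one_mul, one_pow]
    rw [eq_div_of_mul_eq hm ((mul_comm _ _).trans (ascPochhammer_eval_neg_natCast_add k m)),
      Complex.ofReal_neg, pow_add, neg_pow (τ : ℂ) k]
    field_simp
    linear_combination (-τ : ℂ) ^ m * τ ^ k * hsign
  rw [← (summable_pow_div_factorial_mul_eval_neg (-τ) _).sum_add_tsum_nat_add k, hvanish, zero_add,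
    tsum_congr hterm, tsum_mul_left, Complex.exp_eq_exp_ℂ, NormedSpace.exp_eq_tsum_div]

/-- Closing the contour to the left, the right-hand side is the sum of the residues of `Γ` at the
nonpositive integers; the proof instead compares both sides on the basis of rising factorials. -/
theorem mellinInv_Gamma_mul_eval {σ τ : ℝ} (hσ : 0 < σ) (hτ : 0 < τ) (P : ℂ[X]) :
    mellinInv σ (fun s => Complex.Gamma s * P.eval s) τ =
      ∑' n : ℕ, ((-τ : ℝ) : ℂ) ^ n / n ! * P.eval (-n : ℂ) := by
  induction P using ascPochhammer_induction with
  | ascPochhammer k =>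
    rw [mellinInv_Gamma_mul_ascPochhammer hσ hτ, tsum_pow_div_factorial_mul_ascPochhammer]
  | zero => simp [mellinInv]
  | add P Q hP hQ =>
    simp only [Polynomial.eval_add, mul_add]
    rw [mellinInv_add (verticalIntegrable_Gamma_mul_eval hσ P)
      (verticalIntegrable_Gamma_mul_eval hσ Q) hτ, hP, hQ,
      (summable_pow_div_factorial_mul_eval_neg (-τ) P).tsum_add
        (summable_pow_div_factorial_mul_eval_neg (-τ) Q)]
  | smul c P hP =>
    have h := mellinInv_const_smul (fun s => Complex.Gamma s * P.eval s) c σ τ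
    simp only [smul_eq_mul] at h
    simp only [Polynomial.eval_smul, smul_eq_mul, mul_left_comm _ c, h, hP, tsum_mul_left]

end RisingFactorials

section BetaFunction

theorem image_div_one_add_Ioi : (fun x : ℝ => x / (1 + x)) '' Set.Ioi 0 = Set.Ioo 0 1 := by
  ext v
  simp only [Set.mem_image, Set.mem_Ioi, Set.mem_Ioo]
  constructor
  · rintro ⟨x, hx, rfl⟩
    exact ⟨by positivity, by rw [div_lt_one (by positivity)]; linarith⟩
  · rintro ⟨hv0, hv1⟩
    have : 0 < 1 - v := by linarith
    refine ⟨v / (1 - v), by positivity, ?_⟩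
    field_simp
    ring

theorem hasDerivWithinAt_div_one_add {x : ℝ} (hx : x ∈ Set.Ioi (0 : ℝ)) :
    HasDerivWithinAt (fun x : ℝ => x / (1 + x)) (1 / (1 + x) ^ 2) (Set.Ioi 0) x := by
  have hx0 : 1 + x ≠ 0 := by linarith [Set.mem_Ioi.1 hx]
  simpa using
    ((hasDerivAt_id' x).fun_div ((hasDerivAt_id' x).const_add 1) hx0).hasDerivWithinAt

theorem injOn_div_one_add : Set.InjOn (fun x : ℝ => x / (1 + x)) (Set.Ioi 0) := by
  intro x hx y hy h
  have hx0 : 1 + x ≠ 0 := by linarith [Set.mem_Ioi.1 hx]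
  have hy0 : 1 + y ≠ 0 := by linarith [Set.mem_Ioi.1 hy]
  simp only at h
  rw [div_eq_div_iff hx0 hy0] at h
  linarith

theorem beta_integrand_comp_div_one_add {x : ℝ} (hx : 0 < x) (c s : ℂ) :
    |1 / (1 + x) ^ 2| • (((x / (1 + x) : ℝ) : ℂ) ^ (s - 1) *
      (1 - ((x / (1 + x) : ℝ) : ℂ)) ^ (c - s - 1)) =
    (x : ℂ) ^ (s - 1) • ((1 + x : ℝ) : ℂ) ^ (-c) := by
  have hx1 : 0 < 1 + x := by positivity
  have hinv0 : (((1 + x)⁻¹ : ℝ) : ℂ) ≠ 0 := Complex.ofReal_ne_zero.2 (inv_pos.2 hx1).ne'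
  have hcompl : 1 - ((x / (1 + x) : ℝ) : ℂ) = (((1 + x)⁻¹ : ℝ) : ℂ) := by
    rw [← Complex.ofReal_one, ← Complex.ofReal_sub]
    congr 1
    field_simp
    ring
  have hjac : |1 / (1 + x) ^ 2| = ((1 + x)⁻¹) ^ 2 := by
    rw [abs_of_pos (by positivity), inv_pow, one_div]
  have hneg : ((1 + x : ℝ) : ℂ) ^ (-c) = (((1 + x)⁻¹ : ℝ) : ℂ) ^ c := by
    have harg : ((1 + x : ℝ) : ℂ).arg ≠ Real.pi :=
      (Complex.arg_ofReal_of_nonneg hx1.le).trans_ne Real.pi_ne_zero.symm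
    rw [Complex.cpow_neg, Complex.ofReal_inv, Complex.inv_cpow _ _ harg]
  rw [hcompl, hjac, hneg, div_eq_mul_inv, Complex.ofReal_mul,
    Complex.mul_cpow_ofReal_nonneg hx.le (inv_pos.2 hx1).le, Complex.real_smul,
    Complex.ofReal_pow, smul_eq_mul, mul_assoc, ← Complex.cpow_add _ _ hinv0, mul_left_comm,
    ← Complex.cpow_natCast _ 2, ← Complex.cpow_add _ _ hinv0]
  congr 2
  push_cast
  ring

theorem mellinConvergent_one_add_cpow_neg {c s : ℂ} (hs : 0 < s.re) (hc : s.re < c.re) :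
    MellinConvergent (fun x : ℝ => ((1 + x : ℝ) : ℂ) ^ (-c)) s := by
  have h := Complex.betaIntegral_convergent (u := s) (v := c - s) hs (by simpa using hc)
  rw [intervalIntegrable_iff_integrableOn_Ioo_of_le zero_le_one, ← image_div_one_add_Ioi,
    integrableOn_image_iff_integrableOn_abs_deriv_smul measurableSet_Ioi
      (fun _ => hasDerivWithinAt_div_one_add) injOn_div_one_add] at h
  exact h.congr_fun (fun x hx => beta_integrand_comp_div_one_add hx c s) measurableSet_Ioi

theorem mellin_one_add_cpow_neg (c s : ℂ) :
    mellin (fun x : ℝ => ((1 + x : ℝ) : ℂ) ^ (-c)) s = Complex.betaIntegral s (c - s) := by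
  rw [Complex.betaIntegral, intervalIntegral.integral_of_le zero_le_one,
    integral_Ioc_eq_integral_Ioo, ← image_div_one_add_Ioi,
    integral_image_eq_integral_abs_deriv_smul measurableSet_Ioi
      (fun _ => hasDerivWithinAt_div_one_add) injOn_div_one_add]
  exact setIntegral_congr_fun measurableSet_Ioi fun x hx =>
    (beta_integrand_comp_div_one_add hx c s).symm

theorem betaIntegral_sub_eq {t : ℝ} {s : ℂ} (hs : 0 < s.re) (hst : s.re < t) :
    Complex.betaIntegral s (t - s) =
      Complex.Gamma s * Complex.Gamma (t - s) / Complex.Gamma t := by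
  rw [Complex.betaIntegral_eq_Gamma_mul_div _ _ hs (by simpa using hst), add_sub_cancel]

theorem verticalIntegrable_betaIntegral_mul_eval {t σ : ℝ} (hσ : 0 < σ) (hσt : σ < t) (P : ℂ[X]) :
    Complex.VerticalIntegrable (fun s => Complex.betaIntegral s (t - s) * P.eval s) σ := by
  have hreflect : Continuous fun y : ℝ => Complex.Gamma (t - (σ + y * Complex.I)) := by
    refine ((continuous_vertical_Gamma (sub_pos.2 hσt)).comp continuous_neg).congr fun y => ?_
    simp only [Function.comp_apply]
    push_cast
    ring_nf
  have hbdd (y : ℝ) :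
      ‖Complex.Gamma (t - (σ + y * Complex.I)) / Complex.Gamma t‖ ≤
        Real.Gamma (t - σ) / ‖Complex.Gamma t‖ := by
    rw [norm_div]
    gcongr
    simpa using norm_Gamma_le (s := t - (σ + y * Complex.I)) (by simpa using hσt)
  have hmul : Complex.VerticalIntegrable (fun s =>
      Complex.Gamma (t - s) / Complex.Gamma t * (Complex.Gamma s * P.eval s)) σ :=
    Integrable.bdd_mul (f := fun y : ℝ => Complex.Gamma (t - (σ + y * Complex.I)) / Complex.Gamma t)
      (g := fun y : ℝ => Complex.Gamma (σ + y * Complex.I) * P.eval (σ + y * Complex.I))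
      (verticalIntegrable_Gamma_mul_eval hσ P) (hreflect.div_const _).aestronglyMeasurable
      (Eventually.of_forall hbdd)
  refine (verticalIntegrable_congr fun s hs => ?_).1 hmul
  rw [betaIntegral_sub_eq (hs ▸ hσ) (hs ▸ hσt)]
  ring

theorem mellinInv_betaIntegral {t σ x : ℝ} (hσ : 0 < σ) (hσt : σ < t) (hx : 0 < x) :
    mellinInv σ (fun s => Complex.betaIntegral s (t - s)) x = (((1 + x) ^ (-t) : ℝ) : ℂ) := by
  have hx1 : 0 < 1 + x := by positivity
  have hcont : ContinuousAt (fun x : ℝ => ((1 + x : ℝ) : ℂ) ^ (-(t : ℂ))) x :=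
    ContinuousAt.cpow (by fun_prop) continuousAt_const (Complex.ofReal_mem_slitPlane.2 hx1)
  have hmellin : mellin (fun x : ℝ => ((1 + x : ℝ) : ℂ) ^ (-(t : ℂ))) =
      fun s => Complex.betaIntegral s (t - s) :=
    funext fun s => mellin_one_add_cpow_neg t s
  have hvert : Complex.VerticalIntegrable
      (mellin fun x : ℝ => ((1 + x : ℝ) : ℂ) ^ (-(t : ℂ))) σ := by
    simpa only [hmellin, Polynomial.eval_one, mul_one] using
      verticalIntegrable_betaIntegral_mul_eval hσ hσt 1
  rw [← hmellin, mellinInv_mellin_eq σ _ hx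
    (mellinConvergent_one_add_cpow_neg (by simpa) (by simpa)) hvert hcont,
    Complex.ofReal_cpow hx1.le, Complex.ofReal_neg]

theorem betaIntegral_mul_ascPochhammer_eval {t : ℝ} {s : ℂ} (hs : 0 < s.re) (hst : s.re < t)
    (k : ℕ) :
    Complex.betaIntegral s (t - s) * (ascPochhammer ℂ k).eval s =
      (ascPochhammer ℂ k).eval (t : ℂ) *
        Complex.betaIntegral (s + k) (((t + k : ℝ) : ℂ) - (s + k)) := by
  have ht : 0 < ((t : ℂ)).re := by simpa using hs.trans hst
  have hΓt := Complex.Gamma_ne_zero_of_re_pos ht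
  have hpoch := Gamma_mul_ascPochhammer_eval (ne_neg_natCast_of_re_pos ht) k
  have hpoch0 : (ascPochhammer ℂ k).eval (t : ℂ) ≠ 0 := fun h =>
    Complex.Gamma_ne_zero_of_re_pos (s := t + k) (by simpa using by positivity)
      (by rw [← hpoch, h, mul_zero])
  rw [betaIntegral_sub_eq (t := t + k) (by simpa using by positivity) (by simpa using hst),
    betaIntegral_sub_eq hs hst, Complex.ofReal_add, Complex.ofReal_natCast,
    add_sub_add_right_eq_sub,
    ← Gamma_mul_ascPochhammer_eval (ne_neg_natCast_of_re_pos hs), ← hpoch]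
  field_simp

theorem mellinInv_betaIntegral_mul_ascPochhammer {t σ x : ℝ} (hσ : 0 < σ) (hσt : σ < t)
    (hx : 0 < x) (k : ℕ) :
    mellinInv σ (fun s => Complex.betaIntegral s (t - s) * (ascPochhammer ℂ k).eval s) x =
      (((ascPochhammer ℝ k).eval t * x ^ k * (1 + x) ^ (-(t + k)) : ℝ) : ℂ) := by
  have hshift := mellinInv_comp_add
    (fun s => Complex.betaIntegral s (((t + k : ℝ) : ℂ) - s)) k σ hx
  rw [mellinInv_betaIntegral (by positivity) (by linarith) hx] at hshift
  simp only [Complex.ofReal_natCast, Complex.cpow_natCast, smul_eq_mul] at hshift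
  have hcoe : (((ascPochhammer ℝ k).eval t : ℝ) : ℂ) = (ascPochhammer ℂ k).eval (t : ℂ) := by
    rw [← ascPochhammer_map Complex.ofRealHom]
    exact (Polynomial.eval_map_apply (f := Complex.ofRealHom) (p := ascPochhammer ℝ k) t).symm
  rw [mellinInv_congr fun s hs => betaIntegral_mul_ascPochhammer_eval (hs ▸ hσ) (hs ▸ hσt) k]
  have hconst := mellinInv_const_smul (fun s : ℂ =>
    Complex.betaIntegral (s + k) (((t + k : ℝ) : ℂ) - (s + k)))
    ((ascPochhammer ℂ k).eval (t : ℂ)) σ x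
  simp only [smul_eq_mul] at hconst
  rw [hconst, hshift, ← hcoe]
  push_cast
  ring

end BetaFunction

section ScalingLimit

variable {α : Type*} {l : Filter α} {x : α → ℝ} {c : ℝ}

theorem tendsto_ascPochhammer_eval_mul_pow {t : α → ℝ} (hx : Tendsto x l (𝓝 0))
    (htx : Tendsto (fun a => t a * x a) l (𝓝 c)) (k : ℕ) :
    Tendsto (fun a => (ascPochhammer ℝ k).eval (t a) * x a ^ k) l (𝓝 (c ^ k)) := by
  induction k with
  | zero => simp [tendsto_const_nhds]
  | succ k ih =>
    have h : Tendsto (fun a => t a * x a + k * x a) l (𝓝 c) := by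
      simpa using htx.add (hx.const_mul (k : ℝ))
    rw [pow_succ]
    refine (ih.mul h).congr fun a => ?_
    rw [ascPochhammer_succ_eval]
    ring

theorem tendsto_choose_mul_pow {n : α → ℕ} (hx : Tendsto x l (𝓝 0))
    (hnx : Tendsto (fun a => n a * x a) l (𝓝 c)) (k : ℕ) :
    Tendsto (fun a => ((n a).choose k : ℝ) * x a ^ k) l (𝓝 (c ^ k / k !)) := by
  have hneg : Tendsto (fun a => -(n a : ℝ) * -x a) l (𝓝 c) := by simpa only [neg_mul_neg] using hnx
  have hasc := tendsto_ascPochhammer_eval_mul_pow (by simpa using hx.neg) hneg k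
  refine (hasc.div_const _).congr fun a => ?_
  rw [ascPochhammer_eval_neg_eq_descPochhammer, Nat.cast_choose_eq_descPochhammer_div,
    neg_pow (x a), mul_mul_mul_comm, ← mul_pow, neg_mul_neg, one_mul, one_pow, one_mul,
      div_mul_eq_mul_div]

theorem tendsto_one_add_rpow_exp {t : α → ℝ} (hx : Tendsto x l (𝓝[>] 0))
    (htx : Tendsto (fun a => t a * x a) l (𝓝 c)) :
    Tendsto (fun a => (1 + x a) ^ t a) l (𝓝 (Real.exp c)) := by
  have hlog : HasDerivAt (fun y : ℝ => Real.log (1 + y)) 1 0 := by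
    simpa using ((hasDerivAt_id (0 : ℝ)).const_add 1).log (by simp)
  have hquot : Tendsto (fun a => (x a)⁻¹ * Real.log (1 + x a)) l (𝓝 1) :=
    (hlog.tendsto_slope_zero_right.comp hx).congr fun a => by simp
  have hexp := (Real.continuous_exp.tendsto _).comp (htx.mul hquot)
  rw [mul_one] at hexp
  refine hexp.congr' ?_
  filter_upwards [hx self_mem_nhdsWithin] with a ha
  have hpos : 0 < x a := ha
  rw [Function.comp_apply, mul_assoc, mul_inv_cancel_left₀ hpos.ne', mul_comm, Real.exp_mul,
    Real.exp_log (by positivity)]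

theorem tendsto_mellinInv_betaIntegral_mul_eval {t σ : α → ℝ} {σ' : ℝ}
    (hσ : ∀ᶠ a in l, 0 < σ a ∧ σ a < t a) (hx : Tendsto x l (𝓝[>] 0))
    (htx : Tendsto (fun a => t a * x a) l (𝓝 c)) (hσ' : 0 < σ') (hc : 0 < c) (P : ℂ[X]) :
    Tendsto (fun a => mellinInv (σ a)
        (fun s => Complex.betaIntegral s (t a - s) * P.eval s) (x a)) l
      (𝓝 (mellinInv σ' (fun s => Complex.Gamma s * P.eval s) c)) := by
  have hx0 : ∀ᶠ a in l, 0 < x a := hx self_mem_nhdsWithin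
  have hx' : Tendsto x l (𝓝 0) := tendsto_nhds_of_tendsto_nhdsWithin hx
  induction P using ascPochhammer_induction with
  | ascPochhammer k =>
    have hexp := tendsto_one_add_rpow_exp (t := fun a => -(t a + k)) (c := -c) hx <| by
      simpa [add_mul] using (htx.add (hx'.const_mul (k : ℝ))).neg
    have hlim := (tendsto_ascPochhammer_eval_mul_pow hx' htx k).mul hexp
    rw [mellinInv_Gamma_mul_ascPochhammer hσ' hc,
      show (c : ℂ) ^ k * Complex.exp (-c) = ((c ^ k * Real.exp (-c) : ℝ) : ℂ) by push_cast; rfl]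
    refine ((Complex.continuous_ofReal.tendsto _).comp hlim).congr' ?_
    filter_upwards [hσ, hx0] with a ha hxa
    rw [mellinInv_betaIntegral_mul_ascPochhammer ha.1 ha.2 hxa, Function.comp_apply]
  | zero => simp [mellinInv, tendsto_const_nhds]
  | add P Q hP hQ =>
    simp only [Polynomial.eval_add, mul_add]
    rw [mellinInv_add (verticalIntegrable_Gamma_mul_eval hσ' P)
      (verticalIntegrable_Gamma_mul_eval hσ' Q) hc]
    refine (hP.add hQ).congr' ?_
    filter_upwards [hσ, hx0] with a ha hxa
    rw [mellinInv_add (verticalIntegrable_betaIntegral_mul_eval ha.1 ha.2 P)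
      (verticalIntegrable_betaIntegral_mul_eval ha.1 ha.2 Q) hxa]
  | smul b P hP =>
    simp only [Polynomial.eval_smul, smul_eq_mul, mul_left_comm _ b]
    simp only [← smul_eq_mul (a := b), mellinInv_const_smul]
    exact hP.const_smul b

theorem tendsto_natFloor_div_mul {τ : ℝ} (hτ : 0 ≤ τ) :
    Tendsto (fun β : ℝ => (⌊τ / β⌋₊ : ℝ) * β) (𝓝[>] 0) (𝓝 τ) := by
  refine ((tendsto_nat_floor_mul_div_atTop hτ).comp (tendsto_inv_nhdsGT_zero (𝕜 := ℝ))).congr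
    fun β => ?_
  simp [div_eq_mul_inv]

theorem tendsto_div_one_sub_nhdsGT_zero :
    Tendsto (fun β : ℝ => β / (1 - β)) (𝓝[>] 0) (𝓝[>] 0) := by
  refine tendsto_nhdsWithin_iff.2 ⟨?_, ?_⟩
  · have hcont : ContinuousAt (fun β : ℝ => β / (1 - β)) 0 :=
      continuousAt_id.div (by fun_prop) (by norm_num)
    simpa using hcont.tendsto.mono_left nhdsWithin_le_nhds
  · filter_upwards [Ioo_mem_nhdsGT (zero_lt_one' ℝ)] with β hβ
    exact div_pos hβ.1 (sub_pos.2 hβ.2)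

theorem tendsto_natFloor_div_mul_div_one_sub {τ : ℝ} (hτ : 0 ≤ τ) :
    Tendsto (fun β : ℝ => (⌊τ / β⌋₊ : ℝ) * (β / (1 - β))) (𝓝[>] 0) (𝓝 τ) := by
  have hone : Tendsto (fun β : ℝ => 1 - β) (𝓝[>] 0) (𝓝 1) := by
    have hcont : Continuous fun β : ℝ => 1 - β := by fun_prop
    simpa using (hcont.tendsto 0).mono_left (nhdsWithin_le_nhds (s := Set.Ioi 0))
  have h := (tendsto_natFloor_div_mul hτ).div hone one_ne_zero
  rw [div_one] at h
  exact h.congr fun β => mul_div_assoc _ _ _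

end ScalingLimit

section PartialFractions

variable {F ι : Type*} [Field F] [DecidableEq ι] {s : Finset ι} {v : ι → F} {w z : F}

theorem nodal_eval_mul_sum_nodalWeight_mul_inv (hv : Set.InjOn v s) (hs : s.Nonempty)
    (hw : ∀ i ∈ s, w ≠ v i) :
    (Lagrange.nodal s v).eval w * ∑ i ∈ s, Lagrange.nodalWeight s v i * (w - v i)⁻¹ = 1 := by
  simpa [Lagrange.interpolate_one hv hs] using
    (Lagrange.eval_interpolate_not_at_node (r := 1) hw).symm

theorem inv_sub_mul_prod_div_eq (hv : Set.InjOn v s) (hwz : w ≠ z) (hw : ∀ i ∈ s, w ≠ v i)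
    (hz : ∀ i ∈ s, z ≠ v i) :
    (w - z)⁻¹ * ∏ i ∈ s, (z - v i) / (w - v i) =
      (w - z)⁻¹ - ∑ i ∈ s, (w - v i)⁻¹ * (Lagrange.basis s v i).eval z := by
  rcases s.eq_empty_or_nonempty with rfl | hs
  · simp
  have hwz' : w - z ≠ 0 := sub_ne_zero.2 hwz
  have basis_term : ∀ i ∈ s, (w - v i)⁻¹ * (Lagrange.basis s v i).eval z =
      (w - z)⁻¹ * ((Lagrange.nodal s v).eval z * (Lagrange.nodalWeight s v i * (z - v i)⁻¹) -
        (Lagrange.nodal s v).eval z * (Lagrange.nodalWeight s v i * (w - v i)⁻¹)) := by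
    intro i hi
    rw [Lagrange.eval_basis_not_at_node hi (hz i hi)]
    have hwi : w - v i ≠ 0 := sub_ne_zero.2 (hw i hi)
    have hzi : z - v i ≠ 0 := sub_ne_zero.2 (hz i hi)
    field_simp
    ring
  have sum_at_w : ∑ i ∈ s, Lagrange.nodalWeight s v i * (w - v i)⁻¹ =
      ((Lagrange.nodal s v).eval w)⁻¹ :=
    eq_inv_of_mul_eq_one_right (nodal_eval_mul_sum_nodalWeight_mul_inv hv hs hw)
  rw [Finset.sum_congr rfl basis_term, ← Finset.mul_sum, Finset.sum_sub_distrib, ← Finset.mul_sum,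
    ← Finset.mul_sum, nodal_eval_mul_sum_nodalWeight_mul_inv hv hs hz, sum_at_w,
    Finset.prod_div_distrib, Lagrange.eval_nodal, Lagrange.eval_nodal]
  ring

end PartialFractions

section Residues

variable {g : ℂ → ℂ} {b c z : ℂ} {R : ℝ}

theorem circleIntegral_inv_sub_mul (hg : Differentiable ℂ g) (hR : 0 ≤ R) (hb : dist b c ≠ R) :
    (∮ w in C(c, R), (w - b)⁻¹ * g w) =
      if dist b c < R then 2 * Real.pi * Complex.I * g b else 0 := by
  split_ifs with hbR
  · simpa using hg.diffContOnCl.circleIntegral_sub_inv_smul (Metric.mem_ball.2 hbR)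
  · have hne : ∀ w ∈ Metric.closedBall c R, w - b ≠ 0 := by
      rintro w hw hwb
      rw [sub_eq_zero.1 hwb] at hw
      exact hb (le_antisymm hw (not_lt.1 hbR))
    have hd : DifferentiableOn ℂ (fun w => (w - b)⁻¹ * g w) (Metric.closedBall c R) :=
      ((differentiableOn_id.sub_const b).inv hne).mul hg.differentiableOn
    exact Complex.circleIntegral_eq_zero_of_differentiable_on_off_countable hR
      Set.countable_empty hd.continuousOn
      fun w hw => hd.differentiableAt (Metric.closedBall_mem_nhds_of_mem hw.1)

theorem circleIntegrable_inv_sub_mul (hg : Continuous g) (hR : 0 ≤ R) (hb : dist b c ≠ R) :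
    CircleIntegrable (fun w => (w - b)⁻¹ * g w) c R := by
  refine ContinuousOn.circleIntegrable hR ?_
  refine ContinuousOn.mul (ContinuousOn.inv₀ (by fun_prop) fun w hw => ?_) hg.continuousOn
  rintro hwb
  exact hb (sub_eq_zero.1 hwb ▸ hw)

variable {ι : Type*} [DecidableEq ι] {s : Finset ι} {v : ι → ℂ}

theorem circleIntegral_inv_sub_mul_prod_div (hg : Differentiable ℂ g) (hv : Set.InjOn v s)
    (hR : 0 ≤ R) (hvR : ∀ i ∈ s, dist (v i) c ≠ R) (hzR : R < dist z c) (hz : ∀ i ∈ s, z ≠ v i) :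
    (∮ w in C(c, R), (w - z)⁻¹ * g w * ∏ i ∈ s, (z - v i) / (w - v i)) =
      -∑ i ∈ s, (if dist (v i) c < R then 2 * Real.pi * Complex.I * g (v i) else 0) *
        (Lagrange.basis s v i).eval z := by
  have partial_fractions : Set.EqOn (fun w => (w - z)⁻¹ * g w * ∏ i ∈ s, (z - v i) / (w - v i))
      (fun w => (w - z)⁻¹ * g w -
        ∑ i ∈ s, (Lagrange.basis s v i).eval z * ((w - v i)⁻¹ * g w)) (Metric.sphere c R) := by
    intro w hw
    have hwz : w ≠ z := by rintro rfl; exact hzR.ne' hw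
    have hwv : ∀ i ∈ s, w ≠ v i := by rintro i hi rfl; exact hvR i hi hw
    beta_reduce
    rw [mul_right_comm, inv_sub_mul_prod_div_eq hv hwz hwv hz, sub_mul, Finset.sum_mul]
    exact congrArg _ (Finset.sum_congr rfl fun i _ => by ring)
  have integrable_term : ∀ i ∈ s, CircleIntegrable
      (fun w => (Lagrange.basis s v i).eval z * ((w - v i)⁻¹ * g w)) c R := fun i hi =>
    (circleIntegrable_inv_sub_mul hg.continuous hR (hvR i hi)).const_fun_smul
  rw [circleIntegral.integral_congr hR partial_fractions,
    circleIntegral.integral_sub (circleIntegrable_inv_sub_mul hg.continuous hR hzR.ne')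
      (CircleIntegrable.fun_sum _ integrable_term),
    circleIntegral.integral_fun_sum integrable_term, circleIntegral_inv_sub_mul hg hR hzR.ne',
    if_neg hzR.not_gt, zero_sub]
  refine congrArg _ (Finset.sum_congr rfl fun i hi => ?_)
  rw [circleIntegral.integral_const_mul, circleIntegral_inv_sub_mul hg hR (hvR i hi), mul_comm]

end Residues

namespace WContour

variable {σ : ℝ} {P : Set ℤ} (C : WContour σ P) {f g : ℂ → ℂ} {z : ℂ}

theorem integral_congr (h : ∀ w : ℂ, (∀ n : ℤ, w ≠ n) → f w = g w) :
    C.integral f = C.integral g := by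
  refine congrArg₂ (· + ·) (circleIntegral.integral_congr C.rL_nonneg fun w hw => h w ?_)
    (circleIntegral.integral_congr C.rR_nonneg fun w hw => h w ?_)
  · rintro n rfl
    exact C.avoids_left n hw
  · rintro n rfl
    exact C.avoids_right n hw

theorem integral_const_mul (c : ℂ) : C.integral (fun w => c * f w) = c * C.integral f := by
  simp only [WContour.integral, circleIntegral.integral_const_mul, mul_add]

theorem rL_lt_dist (hz : σ ≤ z.re) : C.rL < dist z C.cL := by
  have := Complex.re_le_norm (z - C.cL)
  rw [Complex.sub_re, ← dist_eq_norm] at this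
  linarith [C.left_of_line]

theorem rR_lt_dist (hz : z.re ≤ σ) : C.rR < dist z C.cR := by
  have := Complex.re_le_norm (C.cR - z)
  rw [Complex.sub_re, ← dist_eq_norm, dist_comm] at this
  linarith [C.right_of_line]

theorem ite_add_ite {x : ℂ} {n : ℤ} (hx : n ∉ P → x = 0) :
    (if dist (n : ℂ) C.cL < C.rL then x else 0) + (if dist (n : ℂ) C.cR < C.rR then x else 0) =
      x := by
  by_cases hL : dist (n : ℂ) C.cL < C.rL
  · have hn : (n : ℂ).re < σ := not_le.1 fun h => hL.not_gt (C.rL_lt_dist h)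
    simp [hL, (C.rR_lt_dist hn.le).not_gt]
  · by_cases hR : dist (n : ℂ) C.cR < C.rR
    · simp [hL, hR]
    · simp [hL, hR, hx fun h => (C.encircles n h).elim hL hR]

theorem integral_inv_sub_mul_prod_div {ι : Type*} [DecidableEq ι] {s : Finset ι} {v : ι → ℤ}
    (hg : Differentiable ℂ g) (hv : Set.InjOn v s) (hgP : ∀ i ∈ s, v i ∉ P → g (v i) = 0)
    (hzσ : z.re = σ) (hz : ∀ i ∈ s, z ≠ v i) :
    C.integral (fun w => (w - z)⁻¹ * g w * ∏ i ∈ s, (z - v i) / (w - v i)) =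
      -(2 * Real.pi * Complex.I *
        ∑ i ∈ s, g (v i) * (Lagrange.basis s (fun j => (v j : ℂ)) i).eval z) := by
  have hv' : Set.InjOn (fun i => (v i : ℂ)) s := fun i hi j hj h => hv hi hj (Int.cast_injective h)
  rw [WContour.integral, circleIntegral_inv_sub_mul_prod_div hg hv' C.rL_nonneg
      (fun i _ => C.avoids_left _) (C.rL_lt_dist hzσ.ge) hz,
    circleIntegral_inv_sub_mul_prod_div hg hv' C.rR_nonneg
      (fun i _ => C.avoids_right _) (C.rR_lt_dist hzσ.le) hz,
    ← neg_add, ← Finset.sum_add_distrib, Finset.mul_sum]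
  refine congrArg _ (Finset.sum_congr rfl fun i hi => ?_)
  rw [← add_mul, C.ite_add_ite fun h => by rw [hgP i hi h, mul_zero], mul_assoc]

end WContour

section LineIntegral

variable {F G : ℂ → ℂ} {κ : ℂ} {c σ x : ℝ}

theorem verticalIntegrable_of_eq_cpow_mul_reflect (hx : 0 < x)
    (hF : ∀ z : ℂ, z.re = c - σ → F z = κ * ((x : ℂ) ^ (z - c) * G (c - z)))
    (hG : Complex.VerticalIntegrable G σ) : Complex.VerticalIntegrable F (c - σ) := by
  rw [verticalIntegrable_congr hF, verticalIntegrable_reflect_iff]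
  simp only [sub_sub_cancel_left, sub_sub_cancel]
  exact (verticalIntegrable_cpow_neg_smul hG hx).const_mul κ

theorem lineIntegral_of_eq_cpow_mul_reflect
    (hF : ∀ z : ℂ, z.re = c - σ → F z = κ * ((x : ℂ) ^ (z - c) * G (c - z))) :
    lineIntegral (c - σ) F = κ * (2 * Real.pi * Complex.I * mellinInv σ G x) := by
  have hline (y : ℝ) := hF (((c - σ : ℝ) : ℂ) + y * Complex.I) (by simp)
  rw [← lineIntegral_cpow_mul_reflect G c]
  simp only [lineIntegral, hline, integral_const_mul]
  rw [mul_left_comm]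

theorem mellinInv_mul_eval_sum {ι : Type*} (s : Finset ι) (b : ι → ℂ) (P : ι → ℂ[X])
    (hG : ∀ P : ℂ[X], Complex.VerticalIntegrable (fun u => G u * P.eval u) σ) (hx : 0 < x) :
    mellinInv σ (fun u => G u * (∑ i ∈ s, b i • P i).eval u) x =
      ∑ i ∈ s, b i * mellinInv σ (fun u => G u * (P i).eval u) x := by
  classical
  induction s using Finset.induction_on with
  | empty => simp [mellinInv]
  | insert i s hi ih =>
    simp only [Finset.sum_insert hi, ← ih, Polynomial.eval_add, Polynomial.eval_smul, mul_add,
      smul_eq_mul, mul_left_comm (G _) (b i)]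
    have hPi : Complex.VerticalIntegrable (fun u => b i * (G u * (P i).eval u)) σ :=
      (hG (P i)).const_mul (b i)
    rw [mellinInv_add hPi (hG _) hx]
    exact congrArg (· + _) (mellinInv_const_smul _ (b i) σ x)

end LineIntegral

section ReciprocalGamma

/-- The Poisson weight `t ^ n / n!`, extended by zero to negative `n`. -/
noncomputable def pweight (t : ℝ) (n : ℤ) : ℝ := if 0 ≤ n then t ^ n.toNat / n.toNat ! else 0

theorem pweight_natCast (t : ℝ) (n : ℕ) : pweight t n = t ^ n / n ! := by
  simp [pweight]

theorem pweight_of_neg (t : ℝ) {n : ℤ} (hn : n < 0) : pweight t n = 0 := by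
  simp [pweight, hn]

/-- The binomial coefficient `t` choose `m`, extended by zero to negative `m`. -/
noncomputable def zchoose (t : ℕ) (m : ℤ) : ℝ := if 0 ≤ m then (t.choose m.toNat : ℝ) else 0

theorem zchoose_natCast (t m : ℕ) : zchoose t m = t.choose m := by
  simp [zchoose]

theorem zchoose_eq_zero {t : ℕ} {m : ℤ} (hm : m < 0 ∨ (t : ℤ) < m) : zchoose t m = 0 := by
  unfold zchoose
  split_ifs with h
  · rw [Nat.choose_eq_zero_of_lt (by lia), Nat.cast_zero]
  · rfl

theorem Gamma_intCast_add_one_of_neg {m : ℤ} (hm : m < 0) : Complex.Gamma ((m : ℂ) + 1) = 0 := by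
  obtain ⟨n, hn⟩ : ∃ n : ℕ, m + 1 = -n := ⟨(-(m + 1)).toNat, by lia⟩
  rw [show (m : ℂ) + 1 = -n by exact_mod_cast hn, Complex.Gamma_neg_nat_eq_zero]

theorem inv_Gamma_mul_cpow_eq_pweight (τ : ℝ) (m : ℤ) :
    (Complex.Gamma ((m : ℂ) + 1))⁻¹ * (τ : ℂ) ^ (m : ℂ) = (pweight τ m : ℂ) := by
  rcases lt_or_ge m 0 with hm | hm
  · simp [Gamma_intCast_add_one_of_neg hm, pweight_of_neg τ hm]
  · lift m to ℕ using hm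
    rw [pweight_natCast, Int.cast_natCast, Complex.Gamma_nat_eq_factorial, Complex.cpow_natCast]
    push_cast
    ring

theorem inv_Gamma_mul_inv_Gamma_eq_zchoose (t : ℕ) (m : ℤ) :
    (Complex.Gamma ((m : ℂ) + 1))⁻¹ * (Complex.Gamma ((t : ℂ) - m + 1))⁻¹ =
      (zchoose t m : ℂ) / (t ! : ℂ) := by
  by_cases hm : m < 0 ∨ (t : ℤ) < m
  · rw [zchoose_eq_zero hm, Complex.ofReal_zero, zero_div, mul_eq_zero, inv_eq_zero, inv_eq_zero]
    refine hm.imp Gamma_intCast_add_one_of_neg fun htm => ?_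
    simpa using Gamma_intCast_add_one_of_neg (sub_neg.2 htm)
  · push Not at hm
    lift m to ℕ using hm.1
    have hmt : m ≤ t := by exact_mod_cast hm.2
    rw [zchoose_natCast, Complex.ofReal_natCast, Nat.cast_choose ℂ hmt, Int.cast_natCast,
      ← Nat.cast_sub hmt, Complex.Gamma_nat_eq_factorial, Complex.Gamma_nat_eq_factorial]
    have htf : (t ! : ℂ) ≠ 0 := by exact_mod_cast t.factorial_ne_zero
    field_simp

theorem sin_pi_mul_eq_inv_Gamma (u : ℂ) :
    Complex.sin (Real.pi * u) = Real.pi * ((Complex.Gamma u)⁻¹ * (Complex.Gamma (1 - u))⁻¹) := by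
  have hπ : (Real.pi : ℂ) ≠ 0 := Complex.ofReal_ne_zero.2 Real.pi_ne_zero
  rw [← mul_inv, Complex.Gamma_mul_Gamma_one_sub, inv_div, mul_div_cancel₀ _ hπ]

theorem sin_div_ascPochhammer_eval {u : ℂ} (hu : ∀ m : ℕ, u ≠ -m) (k : ℕ) :
    Complex.sin (Real.pi * u) / (ascPochhammer ℂ k).eval u =
      Real.pi * ((Complex.Gamma (1 - u))⁻¹ * (Complex.Gamma (u + k))⁻¹) := by
  rw [sin_pi_mul_eq_inv_Gamma, ← Gamma_mul_ascPochhammer_eval hu, mul_inv]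
  ring

theorem ascPochhammer_eval_mul_pi_div_sin {u : ℂ} (hu : ∀ m : ℕ, 1 - u ≠ -m) (k : ℕ) :
    (ascPochhammer ℂ k).eval (1 - u) * (Real.pi / Complex.sin (Real.pi * u)) =
      Complex.Gamma u * Complex.Gamma (1 - u + k) := by
  rw [← Complex.Gamma_mul_Gamma_one_sub, ← Gamma_mul_ascPochhammer_eval hu]
  ring

theorem sin_add_intCast_mul_pi (u : ℂ) (n : ℤ) :
    Complex.sin (u + n * Real.pi) = (-1) ^ n * Complex.sin u :=
  n.cast_negOnePow ℂ ▸ Complex.sin_antiperiodic.add_int_mul_eq n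

theorem sin_pi_mul_intCast_sub (u : ℂ) (n : ℤ) :
    Complex.sin (Real.pi * (n - u)) = -((-1) ^ n * Complex.sin (Real.pi * u)) := by
  rw [show (Real.pi : ℂ) * (n - u) = -(Real.pi * u) + n * Real.pi by ring,
    sin_add_intCast_mul_pi, Complex.sin_neg, mul_neg]

theorem differentiable_inv_Gamma_comp {f : ℂ → ℂ} (hf : Differentiable ℂ f) :
    Differentiable ℂ fun w => (Complex.Gamma (f w))⁻¹ :=
  Complex.differentiable_one_div_Gamma.comp hf

theorem differentiable_ofReal_const_cpow {x : ℝ} (hx : 0 < x) {f : ℂ → ℂ}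
    (hf : Differentiable ℂ f) : Differentiable ℂ fun w => (x : ℂ) ^ f w :=
  fun w => (hf w).const_cpow (Or.inl (Complex.ofReal_ne_zero.2 hx.ne'))

theorem ne_intCast_of_re_eq_sub_half {z : ℂ} {m : ℤ} (hz : z.re = (m : ℝ) - 1 / 2) (n : ℤ) :
    z ≠ n := by
  rintro rfl
  rw [Complex.intCast_re] at hz
  have : (2 * n : ℝ) = 2 * m - 1 := by linarith
  have : 2 * n = 2 * m - 1 := by exact_mod_cast this
  lia

end ReciprocalGamma

section PoissonKernel

variable {N : ℕ} (a : Weyl N)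

/-- The operator `f ↦ ∑ t ^ n / n! f(· + n)`, the exponential of `t` times the unit shift. -/
noncomputable def expShift (t : ℝ) (f : ℤ → ℝ) (x : ℤ) : ℝ := ∑' n : ℕ, t ^ n / n ! * f (x + n)

/-- The Lagrange basis polynomials at the nodes `a₁, …, a_N`. -/
noncomputable def lagrangeBasis (r : Fin N) : ℝ[X] :=
  Lagrange.basis Finset.univ (fun i => (a.1 i : ℝ)) r

/-- The complex polynomial `s ↦ L_r(x - s)`, with `L_r` the Lagrange basis polynomial at
`a₁, …, a_N`: the substitution `s = x - z` turns the `z` integrals into Mellin inversions. -/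
noncomputable def reflectedBasis (x : ℤ) (r : Fin N) : ℂ[X] :=
  (Lagrange.basis Finset.univ (fun i => (a.1 i : ℂ)) r).comp (Polynomial.C (x : ℂ) - Polynomial.X)

theorem reflectedBasis_eval (x : ℤ) (r : Fin N) (s : ℂ) : (reflectedBasis a x r).eval s =
    (Lagrange.basis Finset.univ (fun i => (a.1 i : ℂ)) r).eval (x - s) := by
  simp [reflectedBasis]

theorem reflectedBasis_eval_neg_natCast (x : ℤ) (r : Fin N) (n : ℕ) :
    (reflectedBasis a x r).eval (-n : ℂ) =
      (((lagrangeBasis a r).eval ((x + n : ℤ) : ℝ) : ℝ) : ℂ) := by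
  simp [reflectedBasis_eval, lagrangeBasis, Lagrange.basis, Lagrange.basisDivisor,
    Polynomial.eval_prod]

theorem mellinInv_Gamma_mul_reflectedBasis (x : ℤ) (r : Fin N) {σ τ : ℝ} (hσ : 0 < σ)
    (hτ : 0 < τ) :
    mellinInv σ (fun s => Complex.Gamma s * (reflectedBasis a x r).eval s) τ =
      (expShift (-τ) (fun n => (lagrangeBasis a r).eval (n : ℝ)) x : ℂ) := by
  rw [mellinInv_Gamma_mul_eval hσ hτ, expShift, Complex.ofReal_tsum]
  simp only [reflectedBasis_eval_neg_natCast]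
  push_cast
  rfl

theorem poissonInner_eq {x₁ x₂ : ℤ} (C : PoissonContour a x₁ x₂) {τ₁ : ℝ} (hτ₁ : 0 < τ₁) (τ₂ : ℝ)
    {z : ℂ} (hz : z.re = (x₂ : ℝ) - 1 / 2) :
    poissonInner a C τ₁ τ₂ z = -(2 * Real.pi * Complex.I) * ((τ₂ : ℂ) ^ (z - (x₂ : ℝ)) *
      (Complex.Gamma ((x₂ : ℝ) - z) * (∑ r, (pweight τ₁ (x₁ - a.1 r) : ℂ) •
        reflectedBasis a x₂ r).eval ((x₂ : ℝ) - z))) := by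
  set A : ℂ := Complex.Gamma (x₂ - z) * (τ₂ : ℂ) ^ (z - x₂)
  set g : ℂ → ℂ := fun w => A * ((Complex.Gamma (x₁ - w + 1))⁻¹ * (τ₁ : ℂ) ^ (x₁ - w)) with hg
  have g_intCast (n : ℤ) : g n = A * pweight τ₁ (x₁ - n) := by
    rw [← inv_Gamma_mul_cpow_eq_pweight, hg]
    push_cast
    rfl
  have g_differentiable : Differentiable ℂ g :=
    ((differentiable_inv_Gamma_comp (by fun_prop)).mul
      (differentiable_ofReal_const_cpow hτ₁ (by fun_prop))).const_mul A
  have g_eq_zero : ∀ r ∈ Finset.univ, a.1 r ∉ poissonPoles a x₁ → g (a.1 r) = 0 := by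
    intro r _ hr
    have hlt : x₁ - a.1 r < 0 :=
      sub_neg.2 (not_le.1 fun h => hr ⟨h, Set.mem_range_self r⟩)
    rw [g_intCast, pweight_of_neg τ₁ hlt, Complex.ofReal_zero, mul_zero]
  have residues := C.integral_inv_sub_mul_prod_div g_differentiable a.2.injective.injOn
    g_eq_zero hz fun r _ => ne_intCast_of_re_eq_sub_half hz (a.1 r)
  have integrand : poissonInner a C τ₁ τ₂ z =
      C.integral fun w => (w - z)⁻¹ * g w * ∏ r, (z - (a.1 r : ℂ)) / (w - (a.1 r : ℂ)) :=
    C.integral_congr fun w _ => by ring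
  rw [integrand, residues]
  simp only [g_intCast, Polynomial.eval_finsetSum, Polynomial.eval_smul, reflectedBasis_eval,
    Complex.ofReal_intCast, sub_sub_cancel, smul_eq_mul, Finset.mul_sum, ← Finset.sum_neg_distrib]
  exact Finset.sum_congr rfl fun r _ => by ring

theorem verticalIntegrable_poissonInner {x₁ x₂ : ℤ} (C : PoissonContour a x₁ x₂) {τ₁ τ₂ : ℝ}
    (hτ₁ : 0 < τ₁) (hτ₂ : 0 < τ₂) :
    Complex.VerticalIntegrable (poissonInner a C τ₁ τ₂) ((x₂ : ℝ) - 1 / 2) :=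
  verticalIntegrable_of_eq_cpow_mul_reflect (c := x₂)
    (G := fun s => Complex.Gamma s * Polynomial.eval s _) hτ₂
    (fun _ hz => poissonInner_eq a C hτ₁ τ₂ hz)
    (verticalIntegrable_Gamma_mul_eval (by norm_num) _)

theorem lineIntegral_poissonInner {x₁ x₂ : ℤ} (C : PoissonContour a x₁ x₂) {τ₁ τ₂ : ℝ}
    (hτ₁ : 0 < τ₁) (hτ₂ : 0 < τ₂) :
    lineIntegral ((x₂ : ℝ) - 1 / 2) (poissonInner a C τ₁ τ₂) = -(2 * Real.pi * Complex.I) ^ 2 *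
      ∑ r, (pweight τ₁ (x₁ - a.1 r) : ℂ) *
        mellinInv (1 / 2) (fun s => Complex.Gamma s * (reflectedBasis a x₂ r).eval s) τ₂ := by
  rw [lineIntegral_of_eq_cpow_mul_reflect (c := x₂)
    (G := fun s => Complex.Gamma s * Polynomial.eval s _)
    (fun _ hz => poissonInner_eq a C hτ₁ τ₂ hz),
    mellinInv_mul_eval_sum _ _ _ (verticalIntegrable_Gamma_mul_eval (by norm_num)) hτ₂]
  ring

/-- The Poisson kernel in biorthogonal form: the residues at the `w` poles and the Mellin
inversions over the `z` line have been evaluated. -/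
noncomputable def biorthKernel (τ₁ : ℝ) (x₁ : ℤ) (τ₂ : ℝ) (x₂ : ℤ) : ℝ :=
  -(if τ₂ < τ₁ then pweight (τ₁ - τ₂) (x₁ - x₂) else 0) +
    ∑ r, pweight τ₁ (x₁ - a.1 r) * expShift (-τ₂) (fun n => (lagrangeBasis a r).eval (n : ℝ)) x₂

theorem poisson_transition_eq (τ₁ τ₂ : ℝ) (x₁ x₂ : ℤ) :
    (if x₂ ≤ x₁ ∧ τ₂ < τ₁ then
      ((τ₁ : ℂ) - τ₂) ^ (x₁ - x₂).toNat / ((x₁ - x₂).toNat ! : ℂ) else 0) =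
    ((if τ₂ < τ₁ then pweight (τ₁ - τ₂) (x₁ - x₂) else 0 : ℝ) : ℂ) := by
  unfold pweight
  by_cases hτ : τ₂ < τ₁ <;> by_cases hx : x₂ ≤ x₁ <;> simp [hτ, hx]

theorem poissonKernel_eq_mellinInv (C : ∀ x₁ x₂ : ℤ, PoissonContour a x₁ x₂) {τ₁ τ₂ : ℝ}
    (hτ₁ : 0 < τ₁) (hτ₂ : 0 < τ₂) (x₁ x₂ : ℤ) :
    poissonKernel a C τ₁ x₁ τ₂ x₂ =
      -((if τ₂ < τ₁ then pweight (τ₁ - τ₂) (x₁ - x₂) else 0 : ℝ) : ℂ) +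
      ∑ r, (pweight τ₁ (x₁ - a.1 r) : ℂ) *
        mellinInv (1 / 2) (fun s => Complex.Gamma s * (reflectedBasis a x₂ r).eval s) τ₂ := by
  have h2πI : (2 * Real.pi * Complex.I) ^ 2 ≠ 0 := pow_ne_zero 2 Complex.two_pi_I_ne_zero
  rw [poissonKernel, lineIntegral_poissonInner a _ hτ₁ hτ₂, poisson_transition_eq, sub_eq_add_neg,
    neg_mul, mul_neg, neg_neg, one_div, inv_mul_cancel_left₀ h2πI]

theorem poissonKernel_eq_biorthKernel (C : ∀ x₁ x₂ : ℤ, PoissonContour a x₁ x₂) {τ₁ τ₂ : ℝ}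
    (hτ₁ : 0 < τ₁) (hτ₂ : 0 < τ₂) (x₁ x₂ : ℤ) :
    poissonKernel a C τ₁ x₁ τ₂ x₂ = (biorthKernel a τ₁ x₁ τ₂ x₂ : ℂ) := by
  rw [poissonKernel_eq_mellinInv a C hτ₁ hτ₂, biorthKernel]
  simp only [mellinInv_Gamma_mul_reflectedBasis a x₂ _ one_half_pos hτ₂]
  push_cast
  rfl

end PoissonKernel

section BernoulliKernel

theorem sin_div_ascPochhammer_eval_sub_intCast {w : ℂ} (hw : ∀ n : ℤ, w ≠ n) (x : ℤ) (t : ℕ) :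
    Complex.sin (Real.pi * w) / (ascPochhammer ℂ (t + 1)).eval (w - x) =
      (-1) ^ x * Real.pi *
        ((Complex.Gamma (x - w + 1))⁻¹ * (Complex.Gamma (t - (x - w) + 1))⁻¹) := by
  have hwx (m : ℕ) : w - x ≠ -m := fun h => hw (x - m) (by push_cast; linear_combination h)
  have hsin : Complex.sin (Real.pi * w) = (-1) ^ x * Complex.sin (Real.pi * (w - x)) := by
    rw [← sin_add_intCast_mul_pi]
    ring_nf
  rw [hsin, mul_div_assoc, sin_div_ascPochhammer_eval hwx, mul_assoc]
  congr! 5 <;> push_cast <;> ring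

theorem ascPochhammer_eval_mul_pi_div_sin_eq_betaIntegral {z : ℂ} {x : ℤ} {t : ℕ} (ht : 1 ≤ t)
    (hz : z.re = x - (t - 1 / 2 : ℝ)) :
    (ascPochhammer ℂ (t - 1)).eval (z - x + 1) * (Real.pi / Complex.sin (Real.pi * z)) =
      -((-1) ^ x * ((t - 1)! * Complex.betaIntegral (x - z) ((t : ℝ) - (x - z)))) := by
  have ht' : (1 : ℝ) ≤ t := by exact_mod_cast ht
  have hre : ((x : ℂ) - z).re = t - 1 / 2 := by simp [hz]
  have hnat (m : ℕ) : 1 - ((x : ℂ) - z) ≠ -m := fun h =>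
    ne_intCast_of_re_eq_sub_half (m := x - t + 1) (by rw [hz]; push_cast; ring) (x - 1 - m)
      (by push_cast; linear_combination h)
  have hΓ : Complex.Gamma ((t : ℝ) : ℂ) = (t - 1)! := by
    rw [← Complex.Gamma_nat_eq_factorial, Nat.cast_sub ht]
    simp
  have hfact : ((t - 1)! : ℂ) ≠ 0 := by exact_mod_cast (t - 1).factorial_ne_zero
  have hsin : Complex.sin (Real.pi * z) = -((-1) ^ x * Complex.sin (Real.pi * (x - z))) := by
    rw [← sin_pi_mul_intCast_sub, sub_sub_cancel]
  rw [betaIntegral_sub_eq (by rw [hre]; linarith) (by rw [hre]; linarith), hΓ,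
    mul_div_cancel₀ _ hfact, hsin, div_neg, mul_neg, div_mul_eq_div_div_swap,
    show z - x + 1 = 1 - (x - z) by ring, ← mul_div_assoc,
    ascPochhammer_eval_mul_pi_div_sin hnat, Nat.cast_sub ht, div_eq_mul_inv,
    (inv_eq_of_mul_eq_one_left (by simp [← mul_zpow]) : ((-1 : ℂ) ^ x)⁻¹ = (-1) ^ x)]
  push_cast
  ring_nf

theorem ofReal_cpow_sub_eq {ρ : ℝ} (hρ : 0 < ρ) (n x : ℤ) (z : ℂ) :
    (ρ : ℂ) ^ ((n : ℂ) - z) = (ρ ^ (n - x) : ℝ) * ((ρ⁻¹ : ℝ) : ℂ) ^ (z - x) := by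
  have hρ0 : (ρ : ℂ) ≠ 0 := Complex.ofReal_ne_zero.2 hρ.ne'
  have harg : (ρ : ℂ).arg ≠ Real.pi := by
    rw [Complex.arg_ofReal_of_nonneg hρ.le]
    exact Real.pi_pos.ne
  rw [Complex.ofReal_inv, Complex.inv_cpow _ _ harg, ← Complex.cpow_neg, Complex.ofReal_zpow,
    ← Complex.cpow_intCast, ← Complex.cpow_add _ _ hρ0]
  push_cast
  ring_nf

variable {N : ℕ} (a : Weyl N) {β : ℝ}

theorem WContour.integral_sin_div_ascPochhammer {σ : ℝ} {t₁ : ℕ} {x₁ : ℤ}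
    (C : WContour σ (bernoulliPoles a t₁ x₁)) {ρ : ℝ} (hρ : 0 < ρ) {z : ℂ} (hzσ : z.re = σ)
    (hz : ∀ n : ℤ, z ≠ n) :
    C.integral (fun w => (w - z)⁻¹ * (Complex.sin (Real.pi * w) /
        (ascPochhammer ℂ (t₁ + 1)).eval (w - x₁) * (ρ : ℂ) ^ (w - z)) *
        ∏ r, (z - (a.1 r : ℂ)) / (w - (a.1 r : ℂ))) =
      -(2 * Real.pi * Complex.I * ∑ r, (-1) ^ x₁ * Real.pi *
        (zchoose t₁ (x₁ - a.1 r) / (t₁ ! : ℂ)) * (ρ : ℂ) ^ ((a.1 r : ℂ) - z) *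
        (Lagrange.basis Finset.univ (fun i => (a.1 i : ℂ)) r).eval z) := by
  set g : ℂ → ℂ := fun w => (-1) ^ x₁ * Real.pi * ((Complex.Gamma (x₁ - w + 1))⁻¹ *
    (Complex.Gamma (t₁ - (x₁ - w) + 1))⁻¹) * (ρ : ℂ) ^ (w - z) with hg
  have g_intCast (n : ℤ) : g n = (-1) ^ x₁ * Real.pi * (zchoose t₁ (x₁ - n) / (t₁ ! : ℂ)) *
      (ρ : ℂ) ^ ((n : ℂ) - z) := by
    rw [← inv_Gamma_mul_inv_Gamma_eq_zchoose, hg]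
    push_cast
    rfl
  have g_differentiable : Differentiable ℂ g :=
    (((differentiable_inv_Gamma_comp (by fun_prop)).mul
      (differentiable_inv_Gamma_comp (by fun_prop))).const_mul _).mul
      (differentiable_ofReal_const_cpow hρ (by fun_prop))
  have g_eq_zero : ∀ r ∈ Finset.univ, a.1 r ∉ bernoulliPoles a t₁ x₁ → g (a.1 r) = 0 := by
    intro r _ hr
    have hout : x₁ - a.1 r < 0 ∨ (t₁ : ℤ) < x₁ - a.1 r := by
      by_contra! h
      exact hr ⟨⟨by lia, by lia⟩, Set.mem_range_self r⟩
    rw [g_intCast, zchoose_eq_zero hout, Complex.ofReal_zero, zero_div, mul_zero, zero_mul]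
  have integrand := C.integral_congr fun w hw =>
    congrArg (fun u : ℂ => (w - z)⁻¹ * (u * (ρ : ℂ) ^ (w - z)) *
      ∏ r, (z - (a.1 r : ℂ)) / (w - (a.1 r : ℂ)))
      (sin_div_ascPochhammer_eval_sub_intCast hw x₁ t₁)
  rw [integrand, C.integral_inv_sub_mul_prod_div g_differentiable a.2.injective.injOn
    g_eq_zero hzσ fun r _ => hz (a.1 r)]
  simp only [g_intCast]

theorem bernoulliInner_eq (hβ : β ∈ Set.Ioo (0 : ℝ) 1) {t₁ : ℕ} {x₁ : ℤ} {t₂ : ℕ} (ht₂ : 1 ≤ t₂)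
    {x₂ : ℤ} (C : BernoulliContour a t₁ x₁ t₂ x₂) {z : ℂ}
    (hz : z.re = (x₂ : ℝ) - (t₂ - 1 / 2 : ℝ)) :
    bernoulliInner a β C z =
      2 * Real.pi * Complex.I * ((-1) ^ (x₁ + x₂) * (((t₂ - 1)! : ℂ) / (t₁ ! : ℂ))) *
      (((β / (1 - β) : ℝ) : ℂ) ^ (z - (x₂ : ℝ)) *
        (Complex.betaIntegral ((x₂ : ℝ) - z) ((t₂ : ℝ) - ((x₂ : ℝ) - z)) *
          (∑ r, ((zchoose t₁ (x₁ - a.1 r) * ((1 - β) / β) ^ (a.1 r - x₂) : ℝ) : ℂ) •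
            reflectedBasis a x₂ r).eval ((x₂ : ℝ) - z))) := by
  set ρ : ℝ := (1 - β) / β
  have hρ : 0 < ρ := div_pos (sub_pos.2 hβ.2) hβ.1
  have hρinv : β / (1 - β) = ρ⁻¹ := (inv_div _ _).symm
  set A : ℂ := (ascPochhammer ℂ (t₂ - 1)).eval (z - x₂ + 1) / Complex.sin (Real.pi * z)
  have hA : A * Real.pi = -((-1) ^ x₂ * ((t₂ - 1)! *
      Complex.betaIntegral (x₂ - z) ((t₂ : ℝ) - (x₂ - z)))) := by
    rw [← ascPochhammer_eval_mul_pi_div_sin_eq_betaIntegral ht₂ hz]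
    ring
  have integrand : bernoulliInner a β C z = A * C.integral fun w => (w - z)⁻¹ *
      (Complex.sin (Real.pi * w) / (ascPochhammer ℂ (t₁ + 1)).eval (w - x₁) *
        (ρ : ℂ) ^ (w - z)) * ∏ r, (z - (a.1 r : ℂ)) / (w - (a.1 r : ℂ)) := by
    rw [← C.integral_const_mul]
    exact C.integral_congr fun w _ => by ring
  rw [integrand, C.integral_sin_div_ascPochhammer a hρ (by rw [hz]; ring)
    (ne_intCast_of_re_eq_sub_half (m := x₂ - t₂ + 1) (by rw [hz]; push_cast; ring))]
  simp only [ofReal_cpow_sub_eq hρ _ x₂, hρinv, Polynomial.eval_finsetSum,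
    Polynomial.eval_smul, reflectedBasis_eval, Complex.ofReal_intCast, sub_sub_cancel, smul_eq_mul,
    Finset.mul_sum, mul_neg, ← Finset.sum_neg_distrib]
  refine Finset.sum_congr rfl fun r _ => ?_
  rw [zpow_add₀ (neg_ne_zero.2 one_ne_zero)]
  push_cast
  linear_combination (-(2 * Real.pi * Complex.I) * (-1) ^ x₁ * (zchoose t₁ (x₁ - a.1 r) / t₁ !) *
    (ρ : ℂ) ^ (a.1 r - x₂) * ((ρ : ℂ)⁻¹ ^ (z - x₂)) *
    (Lagrange.basis Finset.univ (fun i => (a.1 i : ℂ)) r).eval z) * hA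

theorem lineIntegral_bernoulliInner (hβ : β ∈ Set.Ioo (0 : ℝ) 1) {t₁ : ℕ} {x₁ : ℤ} {t₂ : ℕ}
    (ht₂ : 1 ≤ t₂) {x₂ : ℤ} (C : BernoulliContour a t₁ x₁ t₂ x₂) :
    lineIntegral ((x₂ : ℝ) - t₂ + 1 / 2) (bernoulliInner a β C) =
      (2 * Real.pi * Complex.I) ^ 2 * ((-1) ^ (x₁ + x₂) * (((t₂ - 1)! : ℂ) / (t₁ ! : ℂ))) *
      ∑ r, ((zchoose t₁ (x₁ - a.1 r) * ((1 - β) / β) ^ (a.1 r - x₂) : ℝ) : ℂ) *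
        mellinInv (t₂ - 1 / 2) (fun s => Complex.betaIntegral s ((t₂ : ℝ) - s) *
          (reflectedBasis a x₂ r).eval s) (β / (1 - β)) := by
  have ht₂' : (1 : ℝ) ≤ t₂ := by exact_mod_cast ht₂
  rw [show (x₂ : ℝ) - t₂ + 1 / 2 = x₂ - (t₂ - 1 / 2) by ring,
    lineIntegral_of_eq_cpow_mul_reflect (c := x₂)
      (G := fun s => Complex.betaIntegral s ((t₂ : ℝ) - s) * Polynomial.eval s _)
      (fun _ hz => bernoulliInner_eq a hβ ht₂ C hz),
    mellinInv_mul_eval_sum _ _ _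
      (verticalIntegrable_betaIntegral_mul_eval (by linarith) (by linarith))
      (div_pos hβ.1 (sub_pos.2 hβ.2))]
  ring

theorem bernoulliKernel_eq_mellinInv
    (B : ∀ (t₁ : ℕ) (x₁ : ℤ) (t₂ : ℕ) (x₂ : ℤ), BernoulliContour a t₁ x₁ t₂ x₂)
    (hβ : β ∈ Set.Ioo (0 : ℝ) 1) (t₁ : ℕ) (x₁ : ℤ) {t₂ : ℕ} (ht₂ : 1 ≤ t₂) (x₂ : ℤ) :
    bernoulliKernel a B β t₁ x₁ t₂ x₂ =
      (if x₂ ≤ x₁ ∧ t₂ < t₁ then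
        (-1) ^ ((x₁ - x₂).toNat + 1) * ((t₁ - t₂).choose (x₁ - x₂).toNat : ℂ) else 0) +
      (-1) ^ (x₁ + x₂) *
      ∑ r, ((zchoose t₁ (x₁ - a.1 r) * ((1 - β) / β) ^ (a.1 r - x₂) : ℝ) : ℂ) *
        mellinInv (t₂ - 1 / 2) (fun s => Complex.betaIntegral s ((t₂ : ℝ) - s) *
          (reflectedBasis a x₂ r).eval s) (β / (1 - β)) := by
  have ht₁f : (t₁ ! : ℂ) ≠ 0 := by exact_mod_cast t₁.factorial_ne_zero
  have ht₂f : ((t₂ - 1)! : ℂ) ≠ 0 := by exact_mod_cast (t₂ - 1).factorial_ne_zero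
  have prefactor : (t₁ ! : ℂ) / ((t₂ - 1)! : ℂ) * (1 / (2 * Real.pi * Complex.I) ^ 2) *
      ((2 * Real.pi * Complex.I) ^ 2 * ((-1) ^ (x₁ + x₂) * (((t₂ - 1)! : ℂ) / (t₁ ! : ℂ)))) =
      (-1) ^ (x₁ + x₂) := by
    field_simp
  rw [bernoulliKernel, lineIntegral_bernoulliInner a hβ ht₂, ← mul_assoc _ _ (∑ r, _), prefactor]

theorem tendsto_zchoose_mul_zpow {τ : ℝ} (hτ : 0 ≤ τ) (m : ℤ) :
    Tendsto (fun β : ℝ => zchoose ⌊τ / β⌋₊ m * β ^ m) (𝓝[>] 0) (𝓝 (pweight τ m)) := by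
  rcases lt_or_ge m 0 with hm | hm
  · simp [zchoose_eq_zero (Or.inl hm), pweight_of_neg τ hm]
  · lift m to ℕ using hm
    simpa [zchoose_natCast, pweight_natCast] using
      tendsto_choose_mul_pow (tendsto_id.mono_left nhdsWithin_le_nhds)
        (tendsto_natFloor_div_mul hτ) m

theorem tendsto_zchoose_mul_zpow_sub {τ : ℝ} (hτ : 0 ≤ τ) (m n : ℤ) :
    Tendsto (fun β : ℝ => β ^ (m + n) * (zchoose ⌊τ / β⌋₊ m * ((1 - β) / β) ^ n)) (𝓝[>] 0)
      (𝓝 (pweight τ m)) := by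
  have hone : Tendsto (fun β : ℝ => (1 - β) ^ n) (𝓝[>] 0) (𝓝 1) := by
    have hcont : ContinuousAt (fun β : ℝ => (1 - β) ^ n) 0 :=
      ContinuousAt.zpow₀ (by fun_prop) n (Or.inl (by norm_num))
    simpa using hcont.tendsto.mono_left (nhdsWithin_le_nhds (s := Set.Ioi 0))
  have hlim := (tendsto_zchoose_mul_zpow hτ m).mul hone
  rw [mul_one] at hlim
  refine hlim.congr' ?_
  filter_upwards [self_mem_nhdsWithin] with β hβ
  have hβ0 : β ≠ 0 := hβ.out.ne'
  rw [div_zpow, zpow_add₀ hβ0]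
  field_simp

theorem tendsto_bernoulli_transition (x₁ x₂ : ℤ) {τ₁ τ₂ : ℝ} (hτ₁ : 0 ≤ τ₁) (hτ₂ : 0 ≤ τ₂) :
    Tendsto (fun β : ℝ => (-(β : ℂ)) ^ (x₁ - x₂) *
      (if x₂ ≤ x₁ ∧ ⌊τ₂ / β⌋₊ < ⌊τ₁ / β⌋₊ then (-1) ^ ((x₁ - x₂).toNat + 1) *
        ((⌊τ₁ / β⌋₊ - ⌊τ₂ / β⌋₊).choose (x₁ - x₂).toNat : ℂ) else 0)) (𝓝[>] 0)
      (𝓝 (-((if τ₂ < τ₁ then pweight (τ₁ - τ₂) (x₁ - x₂) else 0 : ℝ) : ℂ))) := by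
  rcases le_or_gt τ₁ τ₂ with hτ | hτ
  · rw [if_neg hτ.not_gt, Complex.ofReal_zero, neg_zero]
    refine tendsto_const_nhds.congr' ?_
    filter_upwards [self_mem_nhdsWithin] with β hβ
    have hfloor : ⌊τ₁ / β⌋₊ ≤ ⌊τ₂ / β⌋₊ :=
      Nat.floor_mono (div_le_div_of_nonneg_right hτ (le_of_lt hβ))
    rw [if_neg fun h => h.2.not_ge hfloor, mul_zero]
  rcases lt_or_ge x₁ x₂ with hx | hx
  · simp [pweight_of_neg _ (sub_neg.2 hx), hx.not_ge]
  obtain ⟨n, hn⟩ := Int.eq_ofNat_of_zero_le (sub_nonneg.2 hx)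
  rw [if_pos hτ, hn, pweight_natCast]
  have hdiff : Tendsto (fun β : ℝ => ((⌊τ₁ / β⌋₊ - ⌊τ₂ / β⌋₊ : ℕ) : ℝ) * β) (𝓝[>] 0)
      (𝓝 (τ₁ - τ₂)) := by
    refine ((tendsto_natFloor_div_mul hτ₁).sub (tendsto_natFloor_div_mul hτ₂)).congr' ?_
    filter_upwards [self_mem_nhdsWithin] with β hβ
    rw [Nat.cast_sub (Nat.floor_mono (div_le_div_of_nonneg_right hτ.le (le_of_lt hβ))), sub_mul]
  have hlt : ∀ᶠ β : ℝ in 𝓝[>] 0, ⌊τ₂ / β⌋₊ < ⌊τ₁ / β⌋₊ := by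
    filter_upwards [hdiff.eventually (lt_mem_nhds (sub_pos.2 hτ))] with β hpos
    by_contra! hle
    simp [Nat.sub_eq_zero_of_le hle] at hpos
  have hlim := (tendsto_choose_mul_pow (tendsto_id.mono_left nhdsWithin_le_nhds) hdiff n).neg
  rw [← Complex.ofReal_neg]
  refine ((Complex.continuous_ofReal.tendsto _).comp hlim).congr' ?_
  filter_upwards [hlt] with β hβ
  have hsign : (-1 : ℂ) ^ n * (-1) ^ n = 1 := by simp [← mul_pow]
  simp only [Function.comp, if_pos (And.intro hx hβ), zpow_natCast, Int.toNat_natCast, id]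
  push_cast
  rw [neg_pow (β : ℂ), pow_succ]
  linear_combination (((⌊τ₁ / β⌋₊ - ⌊τ₂ / β⌋₊).choose n : ℂ) * (β : ℂ) ^ n) * hsign

theorem neg_zpow_sub_mul_neg_one_zpow_add (b : ℂ) (m n : ℤ) :
    (-b) ^ (m - n) * (-1) ^ (m + n) = b ^ (m - n) := by
  have hsign : (-1 : ℂ) ^ (m - n) * (-1) ^ (m + n) = 1 := by
    rw [← zpow_add₀ (neg_ne_zero.2 one_ne_zero)]
    exact Even.neg_one_zpow ⟨m, by ring⟩
  rw [neg_eq_neg_one_mul, mul_zpow, mul_right_comm, hsign, one_mul]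

theorem tendsto_bernoulliKernel (C : ∀ x₁ x₂ : ℤ, PoissonContour a x₁ x₂)
    (B : ∀ (t₁ : ℕ) (x₁ : ℤ) (t₂ : ℕ) (x₂ : ℤ), BernoulliContour a t₁ x₁ t₂ x₂)
    (x₁ x₂ : ℤ) {τ₁ τ₂ : ℝ} (hτ₁ : 0 < τ₁) (hτ₂ : 0 < τ₂) :
    Tendsto (fun β : ℝ => (-(β : ℂ)) ^ (x₁ - x₂) *
      bernoulliKernel a B β ⌊τ₁ / β⌋₊ x₁ ⌊τ₂ / β⌋₊ x₂)
      (𝓝[>] 0) (𝓝 (poissonKernel a C τ₁ x₁ τ₂ x₂)) := by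
  have hfloor : ∀ᶠ β : ℝ in 𝓝[>] 0, 1 ≤ ⌊τ₂ / β⌋₊ := by
    filter_upwards [Ioc_mem_nhdsGT hτ₂] with β hβ
    exact Nat.le_floor (by rw [Nat.cast_one]; exact (one_le_div hβ.1).2 hβ.2)
  have hσ : ∀ᶠ β : ℝ in 𝓝[>] 0, 0 < (⌊τ₂ / β⌋₊ : ℝ) - 1 / 2 ∧
      (⌊τ₂ / β⌋₊ : ℝ) - 1 / 2 < ⌊τ₂ / β⌋₊ := by
    filter_upwards [hfloor] with β hβ
    have : (1 : ℝ) ≤ ⌊τ₂ / β⌋₊ := by exact_mod_cast hβ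
    constructor <;> linarith
  have residue_part := tendsto_finsetSum Finset.univ fun r _ =>
    ((Complex.continuous_ofReal.tendsto _).comp
      (tendsto_zchoose_mul_zpow_sub hτ₁.le (x₁ - a.1 r) (a.1 r - x₂))).mul
      (tendsto_mellinInv_betaIntegral_mul_eval hσ tendsto_div_one_sub_nhdsGT_zero
        (tendsto_natFloor_div_mul_div_one_sub hτ₂.le) one_half_pos hτ₂ (reflectedBasis a x₂ r))
  rw [poissonKernel_eq_mellinInv a C hτ₁ hτ₂]
  refine ((tendsto_bernoulli_transition x₁ x₂ hτ₁.le hτ₂.le).add residue_part).congr' ?_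
  filter_upwards [hfloor, Ioo_mem_nhdsGT (zero_lt_one' ℝ)] with β ht₂ hβ
  rw [bernoulliKernel_eq_mellinInv a B hβ _ _ ht₂, mul_add, ← mul_assoc _ _ (∑ r, _),
    neg_zpow_sub_mul_neg_one_zpow_add, Finset.mul_sum]
  simp only [Function.comp, sub_add_sub_cancel, Complex.ofReal_mul, Complex.ofReal_zpow, mul_assoc]

end BernoulliKernel

section CauchyBinet

theorem hasSum_mul_prod {ι κ : Type*} {f : ι → ℝ} {g : κ → ℝ} {a b : ℝ} (hf : HasSum f a)
    (hg : HasSum g b) : HasSum (fun p : ι × κ => f p.1 * g p.2) (a * b) :=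
  hf.mul hg (summable_mul_of_summable_norm hf.summable.norm hg.summable.norm)

theorem hasSum_pi_prod {n : ℕ} {ι : Type*} {f : Fin n → ι → ℝ} (hf : ∀ i, Summable (f i)) :
    HasSum (fun x : Fin n → ι => ∏ i, f i (x i)) (∏ i, ∑' x, f i x) := by
  induction n with
  | zero => simp
  | succ n ih =>
    have tail := ih (f := fun i => f i.succ) fun i => hf i.succ
    have := hasSum_mul_prod (hf 0).hasSum tail
    rw [Fin.prod_univ_succ, ← (Fin.consEquiv fun _ : Fin (n + 1) => ι).hasSum_iff]
    convert! this using 1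
    ext x
    simp [Fin.consEquiv, Fin.prod_univ_succ]

variable {α : Type*} [LinearOrder α] {n : ℕ}

theorem injective_strictMono_comp_perm : Function.Injective
    fun p : {x : Fin n → α // StrictMono x} × Equiv.Perm (Fin n) => p.1.1 ∘ p.2 := by
  rintro ⟨b, σ⟩ ⟨c, π⟩ (h : b.1 ∘ σ = c.1 ∘ π)
  obtain rfl : b = c := by
    refine Subtype.ext ((StrictMono.range_inj b.2 c.2).1 ?_)
    rw [← σ.surjective.range_comp b.1, h, π.surjective.range_comp]
  exact Prod.ext rfl (Equiv.ext fun i => b.2.injective (congrFun h i))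

theorem mem_range_strictMono_comp_perm {x : Fin n → α} (hx : Function.Injective x) :
    x ∈ Set.range
      fun p : {x : Fin n → α // StrictMono x} × Equiv.Perm (Fin n) => p.1.1 ∘ p.2 := by
  refine ⟨⟨⟨x ∘ Tuple.sort x, ?_⟩, (Tuple.sort x)⁻¹⟩, ?_⟩
  · exact (Tuple.monotone_sort x).strictMono_of_injective (hx.comp (Tuple.sort x).injective)
  · ext i
    simp

theorem det_mul_det_eq_sum_perm {R m : Type*} [CommRing R] [Fintype m] [DecidableEq m]
    (A B : Matrix m m R) :
    A.det * B.det = ∑ σ : Equiv.Perm m, (∏ i, A i (σ i)) * (B.submatrix σ id).det := by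
  rw [← A.det_transpose, Matrix.det_apply', Finset.sum_mul]
  refine Finset.sum_congr rfl fun σ _ => ?_
  rw [Matrix.det_permute]
  simp only [Matrix.transpose_apply]
  ring

theorem hasSum_prod_mul_det {ι : Type*} {A : Fin n → ι → ℝ} {B : ι → Fin n → ℝ}
    (h : ∀ i s, Summable fun x => A i x * B x s) :
    HasSum (fun x : Fin n → ι => (∏ i, A i (x i)) * (Matrix.of fun i s => B (x i) s).det)
      (Matrix.of fun i s => ∑' x, A i x * B x s).det := by
  have expand (x : Fin n → ι) : (∏ i, A i (x i)) * (Matrix.of fun i s => B (x i) s).det =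
      ∑ σ : Equiv.Perm (Fin n), ((Equiv.Perm.sign σ : ℤ) : ℝ) *
        ∏ i, (A i (x i) * B (x i) (σ i)) := by
    rw [← Matrix.det_transpose, Matrix.det_apply', Finset.mul_sum]
    refine Finset.sum_congr rfl fun σ _ => ?_
    simp only [Finset.prod_mul_distrib, Matrix.transpose_apply, Matrix.of_apply]
    ring
  rw [← Matrix.det_transpose, Matrix.det_apply']
  simp_rw [expand]
  exact hasSum_sum fun σ _ => (hasSum_pi_prod fun i => h i (σ i)).mul_left _

theorem det_of_comp_eq_zero {R ι m : Type*} [CommRing R] [Fintype m] [DecidableEq m]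
    (B : ι → m → R) {x : m → ι} (hx : ¬ Function.Injective x) :
    (Matrix.of fun i s => B (x i) s).det = 0 := by
  obtain ⟨i, j, hij, hne⟩ := Function.not_injective_iff.1 hx
  exact Matrix.det_zero_of_row_eq hne (congrArg B hij)

/-- The Cauchy–Binet formula, in infinite dimension. -/
theorem hasSum_det_mul_det {A : Fin n → α → ℝ} {B : α → Fin n → ℝ}
    (h : ∀ i s, Summable fun x => A i x * B x s) :
    HasSum (fun b : {x : Fin n → α // StrictMono x} => (Matrix.of fun i j => A i (b.1 j)).det *
      (Matrix.of fun j s => B (b.1 j) s).det) (Matrix.of fun i s => ∑' x, A i x * B x s).det := by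
  have sum_all := hasSum_prod_mul_det h
  rw [← injective_strictMono_comp_perm.hasSum_iff] at sum_all
  · refine sum_all.prod_fiberwise fun b => ?_
    rw [det_mul_det_eq_sum_perm]
    exact hasSum_fintype _
  · intro x hx
    rw [det_of_comp_eq_zero B fun hinj => hx (mem_range_strictMono_comp_perm hinj), mul_zero]

end CauchyBinet

section DeterminantDerivative

variable {n : Type*} [Fintype n] [DecidableEq n]

theorem hasDerivAt_det {M : ℝ → Matrix n n ℝ} {M' : Matrix n n ℝ} {t : ℝ}
    (h : ∀ i j, HasDerivAt (fun t => M t i j) (M' i j) t) :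
    HasDerivAt (fun t => (M t).det) (∑ i, ((M t).updateRow i (M' i)).det) t := by
  have leibniz (A : Matrix n n ℝ) : A.det = ∑ σ : Equiv.Perm n,
      ((Equiv.Perm.sign σ : ℤ) : ℝ) * ∏ i, A i (σ i) := by
    rw [← Matrix.det_transpose, Matrix.det_apply']
    rfl
  have product_rule : HasDerivAt (fun t => (M t).det) (∑ σ : Equiv.Perm n,
      ((Equiv.Perm.sign σ : ℤ) : ℝ) *
        ∑ i, (∏ j ∈ Finset.univ.erase i, M t j (σ j)) • M' i (σ i)) t := by
    simp_rw [leibniz]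
    exact HasDerivAt.fun_sum fun σ _ => (HasDerivAt.fun_finsetProd fun i _ => h i (σ i)).const_mul _
  refine product_rule.congr_deriv ?_
  simp_rw [leibniz, Finset.mul_sum]
  rw [Finset.sum_comm]
  refine Finset.sum_congr rfl fun i _ => Finset.sum_congr rfl fun σ _ => Eq.symm ?_
  rw [← Finset.mul_prod_erase _ _ (Finset.mem_univ i), Matrix.updateRow_self, smul_eq_mul,
    mul_comm (M' i (σ i))]
  congr 2
  refine Finset.prod_congr rfl fun j hj => ?_
  rw [Matrix.updateRow_ne (Finset.ne_of_mem_erase hj)]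

/-- Both sides are the derivative at `t = 0` of `det (M * (1 + t • A))`. -/
theorem sum_det_updateRow_mul {R : Type*} [CommRing R] (M A : Matrix n n R) :
    ∑ i, (M.updateRow i ((M * A) i)).det = A.trace * M.det := by
  have det_updateRow (i : n) :
      (M.updateRow i ((M * A) i)).det = (M * A * M.adjugate) i i := by
    rw [← Matrix.cramer_transpose_apply, Matrix.cramer_eq_adjugate_mulVec,
      Matrix.mul_apply, ← Matrix.adjugate_transpose]
    simp only [Matrix.mulVec, dotProduct, Matrix.transpose_apply]
    exact Finset.sum_congr rfl fun j _ => mul_comm _ _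
  calc ∑ i, (M.updateRow i ((M * A) i)).det = (M * A * M.adjugate).trace :=
        Finset.sum_congr rfl fun i _ => det_updateRow i
    _ = (A * (M.adjugate * M)).trace := by
        rw [mul_assoc, Matrix.trace_mul_comm, mul_assoc]
    _ = A.trace * M.det := by
        rw [Matrix.adjugate_mul, Matrix.mul_smul, mul_one, Matrix.trace_smul, smul_eq_mul, mul_comm]

end DeterminantDerivative

section ExponentialShift

/-- The functions on which all the operators `expShift t` converge absolutely. -/
def ExpSummable (f : ℤ → ℝ) : Prop :=
  ∀ (t : ℝ) (x : ℤ), Summable fun n : ℕ => t ^ n / n ! * f (x + n)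

theorem ExpSummable.add {f g : ℤ → ℝ} (hf : ExpSummable f) (hg : ExpSummable g) :
    ExpSummable fun x => f x + g x := fun t x => by
  simpa only [mul_add] using (hf t x).add (hg t x)

theorem ExpSummable.const_mul {f : ℤ → ℝ} (hf : ExpSummable f) (c : ℝ) :
    ExpSummable fun x => c * f x := fun t x => by
  simpa only [mul_left_comm] using (hf t x).mul_left c

theorem ExpSummable.sum {ι : Type*} {s : Finset ι} {f : ι → ℤ → ℝ}
    (hf : ∀ i ∈ s, ExpSummable (f i)) : ExpSummable fun x => ∑ i ∈ s, f i x := fun t x => by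
  simp only [Finset.mul_sum]
  exact summable_sum fun i hi => hf i hi t x

theorem expShift_add {f g : ℤ → ℝ} (hf : ExpSummable f) (hg : ExpSummable g) (t : ℝ) (x : ℤ) :
    expShift t (fun x => f x + g x) x = expShift t f x + expShift t g x := by
  simp only [expShift, mul_add]
  exact (hf t x).tsum_add (hg t x)

theorem expShift_const_mul (f : ℤ → ℝ) (c t : ℝ) (x : ℤ) :
    expShift t (fun x => c * f x) x = c * expShift t f x := by
  simp only [expShift, ← tsum_mul_left, mul_left_comm c]

theorem expShift_sum {ι : Type*} {s : Finset ι} {f : ι → ℤ → ℝ}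
    (hf : ∀ i ∈ s, ExpSummable (f i)) (t : ℝ) (x : ℤ) :
    expShift t (fun x => ∑ i ∈ s, f i x) x = ∑ i ∈ s, expShift t (f i) x := by
  simp only [expShift, Finset.mul_sum]
  exact Summable.tsum_finsetSum fun i hi => hf i hi t x

theorem sum_antidiagonal_pow_div_factorial (s t : ℝ) (k : ℕ) :
    ∑ p ∈ Finset.HasAntidiagonal.antidiagonal k, s ^ p.1 / p.1 ! * (t ^ p.2 / p.2 !) =
      (s + t) ^ k / k ! := by
  rw [(Commute.all s t).add_pow', Finset.sum_div]
  refine Finset.sum_congr rfl fun p hp => ?_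
  rw [Finset.HasAntidiagonal.mem_antidiagonal] at hp
  have choose_mul : (k.choose p.1 * p.2 ! * p.1 ! : ℝ) = k ! := by
    rw [← hp, add_comm]
    exact_mod_cast Nat.add_choose_mul_factorial_mul_factorial p.2 p.1
  rw [nsmul_eq_mul, ← choose_mul]
  have : (k.choose p.1 : ℝ) ≠ 0 := by
    exact_mod_cast (Nat.choose_pos (hp ▸ Nat.le_add_right _ _)).ne'
  field_simp

theorem ExpSummable.summable_prod {f : ℤ → ℝ} (hf : ExpSummable f) (s t : ℝ) (x : ℤ) :
    Summable fun p : ℕ × ℕ => s ^ p.1 / p.1 ! * (t ^ p.2 / p.2 !) * f (x + (p.1 + p.2 : ℕ)) := by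
  rw [← summable_norm_iff, ← Finset.HasAntidiagonal.sigmaAntidiagonalEquivProd.summable_iff]
  refine (summable_sigma_of_nonneg fun _ => norm_nonneg _).2 ?_
  refine ⟨fun k => (hasSum_fintype _).summable, ?_⟩
  refine (hf (|s| + |t|) x).norm.congr fun k => ?_
  rw [tsum_fintype, ← sum_antidiagonal_pow_div_factorial, norm_mul, Real.norm_of_nonneg
    (Finset.sum_nonneg fun _ _ => by positivity), Finset.sum_mul, ← Finset.sum_coe_sort]
  refine Finset.sum_congr rfl fun p _ => ?_
  have hp := Finset.HasAntidiagonal.mem_antidiagonal.1 p.2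
  simp [Finset.HasAntidiagonal.sigmaAntidiagonalEquivProd, ← hp]

theorem ExpSummable.hasSum_expShift {f : ℤ → ℝ} (hf : ExpSummable f) (s t : ℝ) (x : ℤ) :
    HasSum (fun n : ℕ => s ^ n / n ! * expShift t f (x + n)) (expShift (s + t) f x) := by
  set F : ℕ × ℕ → ℝ := fun p => s ^ p.1 / p.1 ! * (t ^ p.2 / p.2 !) * f (x + (p.1 + p.2 : ℕ))
  have total : HasSum F (∑' p, F p) := (hf.summable_prod s t x).hasSum
  have by_rows : HasSum (fun n : ℕ => s ^ n / n ! * expShift t f (x + n)) (∑' p, F p) := by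
    refine total.prod_fiberwise fun n => ?_
    refine ((hf t (x + n)).hasSum.mul_left (s ^ n / n !)).congr_fun fun m => ?_
    simp only [F]
    push_cast
    rw [mul_assoc, add_assoc]
  have by_antidiagonals : HasSum (fun k : ℕ => (s + t) ^ k / k ! * f (x + k)) (∑' p, F p) := by
    rw [← Finset.HasAntidiagonal.sigmaAntidiagonalEquivProd.hasSum_iff] at total
    refine total.sigma fun k => ?_
    convert! hasSum_fintype fun p : Finset.HasAntidiagonal.antidiagonal k => F p.1 using 1
    rw [Finset.sum_coe_sort (Finset.HasAntidiagonal.antidiagonal k) F,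
      ← sum_antidiagonal_pow_div_factorial, Finset.sum_mul]
    refine Finset.sum_congr rfl fun p hp => ?_
    rw [← Finset.HasAntidiagonal.mem_antidiagonal.1 hp]
  rwa [expShift, by_antidiagonals.tsum_eq]

theorem ExpSummable.expShift {f : ℤ → ℝ} (hf : ExpSummable f) (t : ℝ) :
    ExpSummable (expShift t f) := fun s x => (hf.hasSum_expShift s t x).summable

theorem expShift_expShift {f : ℤ → ℝ} (hf : ExpSummable f) (s t : ℝ) (x : ℤ) :
    expShift s (expShift t f) x = expShift (s + t) f x :=
  (hf.hasSum_expShift s t x).tsum_eq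

theorem ExpSummable.hasSum_pweight {f : ℤ → ℝ} (hf : ExpSummable f) (t : ℝ) (x : ℤ) :
    HasSum (fun y : ℤ => pweight t (y - x) * f y) (NoncollidingWalk.expShift t f x) := by
  have add_injective : Function.Injective fun n : ℕ => x + (n : ℤ) := fun m n h => by
    simpa using h
  rw [← add_injective.hasSum_iff]
  · refine (hf t x).hasSum.congr_fun fun n => ?_
    simp [pweight_natCast]
  · intro y hy
    rw [pweight_of_neg, zero_mul]
    by_contra h
    exact hy ⟨(y - x).toNat, by simp only; lia⟩

theorem expSummable_single (y : ℤ) (c : ℝ) : ExpSummable (Pi.single y c) := fun t x => by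
  refine summable_of_hasFiniteSupport ((Set.finite_singleton (y - x).toNat).subset fun n hn => ?_)
  by_contra h
  rw [Set.mem_singleton_iff] at h
  exact hn (mul_eq_zero_of_right _ (Pi.single_eq_of_ne (by lia) _))

theorem expShift_single (t : ℝ) (y x : ℤ) (c : ℝ) :
    expShift t (Pi.single y c) x = pweight t (y - x) * c := by
  rw [← ((expSummable_single y c).hasSum_pweight t x).tsum_eq, tsum_eq_single y]
  · rw [Pi.single_eq_same]
  · intro z hz
    rw [Pi.single_eq_of_ne hz, mul_zero]

theorem hasSum_expShift_pow (t : ℝ) (m : ℕ) (x : ℤ) :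
    HasSum (fun n : ℕ => t ^ n / n ! * ((x + n : ℤ) : ℝ) ^ m)
      (∑ j ∈ Finset.range (m + 1), (x : ℝ) ^ j *
        (m.choose j * expShift t (fun n => (n : ℝ) ^ (m - j)) 0)) := by
  have moment (i : ℕ) : HasSum (fun n : ℕ => t ^ n / n ! * (n : ℝ) ^ i)
      (expShift t (fun n => (n : ℝ) ^ i) 0) := by
    simpa [expShift] using (summable_pow_div_factorial_mul_pow t i).hasSum
  refine (hasSum_sum fun j _ => ((moment (m - j)).mul_left _).mul_left ((x : ℝ) ^ j)).congr_fun
    fun n => ?_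
  push_cast
  rw [add_pow, Finset.mul_sum]
  exact Finset.sum_congr rfl fun j _ => by ring

theorem expSummable_pow (m : ℕ) : ExpSummable fun x => (x : ℝ) ^ m := fun t x =>
  (hasSum_expShift_pow t m x).summable

theorem expShift_pow (t : ℝ) (m : ℕ) (x : ℤ) :
    expShift t (fun n => (n : ℝ) ^ m) x = ∑ j ∈ Finset.range (m + 1), (x : ℝ) ^ j *
      (m.choose j * expShift t (fun n => (n : ℝ) ^ (m - j)) 0) :=
  (hasSum_expShift_pow t m x).tsum_eq

theorem expShift_one (t : ℝ) (x : ℤ) : expShift t (fun _ => 1) x = Real.exp t := by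
  simp [expShift, Real.exp_eq_exp_ℝ, NormedSpace.exp_eq_tsum_div]

end ExponentialShift

section Vandermonde

variable {N : ℕ}

theorem det_vandermonde_eq (x : Weyl N) :
    (Matrix.vandermonde fun i => (x.1 i : ℝ)).det = vandermonde x := by
  rw [Matrix.det_vandermonde, vandermonde, Finset.prod_sigma', Finset.prod_sigma']
  refine Finset.prod_bij' (fun p _ => ⟨p.2, p.1⟩) (fun p _ => ⟨p.2, p.1⟩) ?_ ?_ ?_ ?_ ?_ <;> simp

theorem one_le_vandermonde (x : Weyl N) : 1 ≤ vandermonde x := by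
  refine Finset.one_le_prod fun i _ => Finset.one_le_prod fun j hj => ?_
  have : (x.1 j : ℝ) + 1 ≤ x.1 i := by exact_mod_cast x.2 (Finset.mem_Iio.1 hj)
  linarith

theorem vandermonde_pos (x : Weyl N) : 0 < vandermonde x :=
  zero_lt_one.trans_le (one_le_vandermonde x)

theorem sum_range_choose_mul {R : Type*} [Semiring R] (m : Fin N) (f : ℕ → R) :
    ∑ j ∈ Finset.range (m + 1), f j * (m : ℕ).choose j =
      ∑ j : Fin N, f j * (m : ℕ).choose j := by
  rw [Fin.sum_univ_eq_sum_range (fun j => f j * (m : ℕ).choose j) N]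
  refine Finset.sum_subset (Finset.range_subset_range.2 m.2) fun j _ hj => ?_
  rw [Finset.mem_range, not_lt] at hj
  rw [Nat.choose_eq_zero_of_lt hj, Nat.cast_zero, mul_zero]

theorem injOn_intCast_weyl (a : Weyl N) (s : Set (Fin N)) :
    Set.InjOn (fun i => (a.1 i : ℝ)) s :=
  (Int.cast_injective.comp a.2.injective).injOn

theorem lagrangeBasis_eval_eq_sum (a : Weyl N) (r : Fin N) (x : ℝ) :
    (lagrangeBasis a r).eval x = ∑ m : Fin N, x ^ (m : ℕ) * (lagrangeBasis a r).coeff m := by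
  have natDegree_lt : (lagrangeBasis a r).natDegree < N := by
    rw [lagrangeBasis, Lagrange.natDegree_basis (injOn_intCast_weyl a _) (Finset.mem_univ r),
      Finset.card_univ, Fintype.card_fin]
    exact Nat.sub_one_lt_of_lt r.pos
  rw [Polynomial.eval_eq_sum_range' natDegree_lt,
    Fin.sum_univ_eq_sum_range (fun m => x ^ m * (lagrangeBasis a r).coeff m) N]
  exact Finset.sum_congr rfl fun m _ => mul_comm _ _

theorem lagrangeBasis_eval_node (a : Weyl N) (r i : Fin N) :
    (lagrangeBasis a r).eval (a.1 i : ℝ) = (1 : Matrix (Fin N) (Fin N) ℝ) i r := by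
  rw [Matrix.one_apply]
  split_ifs with h
  · subst h
    exact Lagrange.eval_basis_self (injOn_intCast_weyl a _) (Finset.mem_univ i)
  · exact Lagrange.eval_basis_of_ne (v := fun i => (a.1 i : ℝ)) (Ne.symm h) (Finset.mem_univ i)

theorem expSummable_lagrangeBasis (a : Weyl N) (r : Fin N) :
    ExpSummable fun n => (lagrangeBasis a r).eval (n : ℝ) := by
  simp_rw [lagrangeBasis_eval_eq_sum, mul_comm _ ((lagrangeBasis a r).coeff _)]
  exact ExpSummable.sum fun m _ => (expSummable_pow m).const_mul _

theorem expShift_lagrangeBasis (a : Weyl N) (r : Fin N) (t : ℝ) (x : ℤ) :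
    expShift t (fun n => (lagrangeBasis a r).eval (n : ℝ)) x =
      ∑ m : Fin N, expShift t (fun n => (n : ℝ) ^ (m : ℕ)) x * (lagrangeBasis a r).coeff m := by
  simp_rw [lagrangeBasis_eval_eq_sum, mul_comm _ ((lagrangeBasis a r).coeff _)]
  rw [expShift_sum (f := fun (m : Fin N) (n : ℤ) => (lagrangeBasis a r).coeff m *
    (n : ℝ) ^ (m : ℕ)) fun m _ => (expSummable_pow m).const_mul _]
  exact Finset.sum_congr rfl fun m _ => expShift_const_mul _ _ _ _

theorem det_expShift_pow (b : Fin N → ℤ) (t : ℝ) :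
    (Matrix.of fun i m : Fin N => expShift t (fun n => (n : ℝ) ^ (m : ℕ)) (b i)).det =
      Real.exp (N * t) * (Matrix.vandermonde fun i => (b i : ℝ)).det := by
  set U : Matrix (Fin N) (Fin N) ℝ := Matrix.of fun j m =>
    expShift t (fun n => (n : ℝ) ^ ((m : ℕ) - j)) 0 * (m : ℕ).choose j with hU
  have factor : (Matrix.of fun i m : Fin N => expShift t (fun n => (n : ℝ) ^ (m : ℕ)) (b i)) =
      Matrix.vandermonde (fun i => (b i : ℝ)) * U := by
    ext i m
    rw [Matrix.of_apply, expShift_pow, Matrix.mul_apply]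
    simp only [Matrix.vandermonde_apply, hU, Matrix.of_apply, mul_comm ((m : ℕ).choose _ : ℝ),
      ← mul_assoc]
    exact sum_range_choose_mul m
      fun j => (b i : ℝ) ^ j * expShift t (fun n => (n : ℝ) ^ ((m : ℕ) - j)) 0
  have det_U : U.det = Real.exp (N * t) := by
    rw [Matrix.det_of_isUpperTriangular]
    · simp [hU, expShift_one, Real.exp_nat_mul]
    · intro j m hjm
      simp [hU, Nat.choose_eq_zero_of_lt (show (m : ℕ) < j from hjm)]
  rw [factor, Matrix.det_mul, det_U, mul_comm]

theorem det_expShift_lagrangeBasis (a b : Weyl N) (t : ℝ) :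
    (Matrix.of fun i r => expShift t (fun n => (lagrangeBasis a r).eval (n : ℝ)) (b.1 i)).det =
      Real.exp (N * t) * (vandermonde b / vandermonde a) := by
  set coeffs : Matrix (Fin N) (Fin N) ℝ := Matrix.of fun m r => (lagrangeBasis a r).coeff m
  have factor :
      (Matrix.of fun i r => expShift t (fun n => (lagrangeBasis a r).eval (n : ℝ)) (b.1 i)) =
        Matrix.of (fun i m : Fin N => expShift t (fun n => (n : ℝ) ^ (m : ℕ)) (b.1 i)) *
          coeffs := by
    ext i r
    simp only [Matrix.of_apply, expShift_lagrangeBasis, Matrix.mul_apply, coeffs]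
  have interpolation : Matrix.vandermonde (fun i => (a.1 i : ℝ)) * coeffs = 1 := by
    ext i r
    rw [← lagrangeBasis_eval_node a, lagrangeBasis_eval_eq_sum, Matrix.mul_apply]
    rfl
  have det_coeffs : coeffs.det = (vandermonde a)⁻¹ := by
    refine eq_inv_of_mul_eq_one_right ?_
    rw [← det_vandermonde_eq, ← Matrix.det_mul, interpolation, Matrix.det_one]
  rw [factor, Matrix.det_mul, det_expShift_pow, det_vandermonde_eq, det_coeffs, div_eq_mul_inv,
    mul_assoc]

end Vandermonde

section Generator

variable {N : ℕ}

/-- The vector `x + e_i`, to which the walk at `x` jumps if it is still strictly increasing. -/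
def bump (x : Fin N → ℤ) (i : Fin N) : Fin N → ℤ := Function.update x i (x i + 1)

theorem bump_apply_self (x : Fin N → ℤ) (i : Fin N) : bump x i i = x i + 1 :=
  Function.update_self ..

theorem bump_apply_of_ne (x : Fin N → ℤ) {i j : Fin N} (h : j ≠ i) : bump x i j = x j :=
  Function.update_of_ne h ..

theorem bump_injective (x : Fin N → ℤ) : Function.Injective (bump x) := by
  intro i j h
  by_contra hne
  have := congrFun h i
  rw [bump_apply_self, bump_apply_of_ne x hne] at this
  lia

theorem bump_ne_self (x : Fin N → ℤ) (i : Fin N) : bump x i ≠ x := fun h => by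
  have := congrFun h i
  rw [bump_apply_self] at this
  lia

theorem strictMono_bump_of_injective (x : Weyl N) {i : Fin N}
    (h : Function.Injective (bump x.1 i)) : StrictMono (bump x.1 i) := by
  refine Monotone.strictMono_of_injective (fun j k hjk => ?_) h
  rcases hjk.eq_or_lt with rfl | hlt
  · rfl
  have hx : x.1 j < x.1 k := x.2 hlt
  grind [bump_apply_self, bump_apply_of_ne]

/-- The Vandermonde determinant is harmonic: the row updates come from the upper unitriangular
change of basis `X ^ m ↦ (X + 1) ^ m`. -/
theorem sum_det_vandermonde_bump (x : Fin N → ℤ) :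
    ∑ i, (Matrix.vandermonde fun j => (bump x i j : ℝ)).det =
      N * (Matrix.vandermonde fun i => (x i : ℝ)).det := by
  set A : Matrix (Fin N) (Fin N) ℝ := Matrix.of fun j m => ((m : ℕ).choose j : ℝ) with hA
  have trace_A : A.trace = N := by simp [hA, Matrix.trace]
  rw [← trace_A, ← sum_det_updateRow_mul]
  refine Finset.sum_congr rfl fun i _ => congrArg Matrix.det ?_
  ext j m
  by_cases hj : j = i
  · subst hj
    rw [Matrix.updateRow_self, Matrix.vandermonde_apply, bump_apply_self, Matrix.mul_apply,
      Int.cast_add, Int.cast_one, add_pow]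
    simp only [one_pow, mul_one]
    exact sum_range_choose_mul m fun k => (x j : ℝ) ^ k
  · rw [Matrix.updateRow_ne hj, Matrix.vandermonde_apply, Matrix.vandermonde_apply,
      bump_apply_of_ne x hj]

open Classical in
/-- The generator of the noncolliding Poisson random walk. -/
noncomputable def generator (f : Weyl N → ℝ) (x : Weyl N) : ℝ :=
  -(N : ℝ) * f x + ∑ i, if h : StrictMono (bump x.1 i) then
    vandermonde ⟨_, h⟩ / vandermonde x * f ⟨_, h⟩ else 0

open Classical in
theorem sum_ite_strictMono_bump (x : Weyl N) {E : (Fin N → ℤ) → ℝ}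
    (hE : ∀ y, ¬ Function.Injective y → E y = 0) :
    (∑ i, if StrictMono (bump x.1 i) then E (bump x.1 i) else 0) = ∑ i, E (bump x.1 i) := by
  refine Finset.sum_congr rfl fun i _ => ?_
  split_ifs with h
  · rfl
  · rw [hE _ fun hinj => h (strictMono_bump_of_injective x hinj)]

open Classical in
theorem sum_vandermonde_bump (x : Weyl N) :
    (∑ i, if h : StrictMono (bump x.1 i) then vandermonde ⟨_, h⟩ / vandermonde x else 0) = N := by
  have harmonic : (∑ i, if StrictMono (bump x.1 i) then
      (Matrix.vandermonde fun j => (bump x.1 i j : ℝ)).det else 0) = N * vandermonde x := by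
    rw [← det_vandermonde_eq, ← sum_det_vandermonde_bump]
    exact sum_ite_strictMono_bump x (E := fun y => (Matrix.vandermonde fun j => (y j : ℝ)).det)
      fun y hy => det_of_comp_eq_zero (fun (n : ℤ) (j : Fin N) => (n : ℝ) ^ (j : ℕ)) hy
  rw [eq_comm, ← mul_div_cancel_right₀ (N : ℝ) (vandermonde_pos x).ne', ← harmonic,
    Finset.sum_div]
  refine Finset.sum_congr rfl fun i _ => ?_
  split_ifs with h
  · rw [← det_vandermonde_eq ⟨_, h⟩]
  · exact zero_div _

theorem generator_one (x : Weyl N) : generator (fun _ => 1) x = 0 := by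
  simp only [generator, mul_one]
  rw [sum_vandermonde_bump, neg_add_cancel]

theorem generator_sub (f g : Weyl N → ℝ) (x : Weyl N) :
    generator (fun y => f y - g y) x = generator f x - generator g x := by
  unfold generator
  rw [add_sub_add_comm, ← Finset.sum_sub_distrib, mul_sub]
  congr 1
  refine Finset.sum_congr rfl fun i _ => ?_
  split_ifs <;> ring

theorem abs_generator_le {f : Weyl N → ℝ} {B : ℝ} (hf : ∀ y, |f y| ≤ B) (x : Weyl N) :
    |generator f x| ≤ 2 * N * B := by
  classical
  have jumps : |∑ i, if h : StrictMono (bump x.1 i) then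
      vandermonde ⟨_, h⟩ / vandermonde x * f ⟨_, h⟩ else 0| ≤ N * B := by
    rw [← sum_vandermonde_bump x, Finset.sum_mul]
    refine (Finset.abs_sum_le_sum_abs _ _).trans (Finset.sum_le_sum fun i _ => ?_)
    split_ifs with h
    · have : 0 < vandermonde ⟨_, h⟩ / vandermonde x :=
        div_pos (vandermonde_pos _) (vandermonde_pos x)
      rw [abs_mul, abs_of_pos this]
      gcongr
      exact hf _
    · simp
  have holding : |-(N : ℝ) * f x| ≤ N * B := by
    rw [abs_mul, abs_neg, Nat.abs_cast]
    gcongr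
    exact hf _
  calc |generator f x| ≤ N * B + N * B := (abs_add_le _ _).trans (add_le_add holding jumps)
    _ = 2 * N * B := by ring

theorem exists_sum_rate_eq_generator (x : Weyl N) : ∃ F : Finset (Weyl N), x ∈ F ∧
    ∀ f : Weyl N → ℝ, ∑ y ∈ F, poissonRate x y * f y = generator f x := by
  classical
  set G : {i // StrictMono (bump x.1 i)} ↪ Weyl N :=
    ⟨fun i => ⟨bump x.1 i.1, i.2⟩, fun i j h => Subtype.ext (bump_injective x.1
      (congrArg Subtype.val h))⟩
  have x_notMem : x ∉ Finset.univ.map G := by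
    simp only [Finset.mem_map, not_exists, not_and]
    intro i _ h
    exact bump_ne_self x.1 i.1 (congrArg Subtype.val h)
  refine ⟨insert x (Finset.univ.map G), Finset.mem_insert_self _ _, fun f => ?_⟩
  rw [Finset.sum_insert x_notMem, generator, Finset.sum_map]
  congr 1
  · congr 1
    rw [poissonRate, if_neg, if_pos rfl]
    rintro ⟨i, hi⟩
    exact bump_ne_self x.1 i hi.symm
  · rw [Finset.sum_dite, Finset.sum_const_zero, add_zero]
    refine Finset.sum_bij' (fun i _ => ⟨i.1, Finset.mem_filter.2 ⟨Finset.mem_univ _, i.2⟩⟩)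
      (fun i _ => ⟨i.1, (Finset.mem_filter.1 i.2).2⟩)
      (fun _ _ => Finset.mem_attach _ _) (fun _ _ => Finset.mem_univ _) (fun _ _ => rfl)
      (fun _ _ => rfl) fun i _ => ?_
    rw [poissonRate, if_pos ⟨i, rfl⟩]
    rfl

end Generator

section KarlinMcGregor

theorem hasDerivAt_pow_succ_div_factorial (n : ℕ) (t : ℝ) :
    HasDerivAt (fun t : ℝ => t ^ (n + 1) / (n + 1)!) (t ^ n / n !) t := by
  refine ((hasDerivAt_pow (n + 1) t).div_const ((n + 1)! : ℝ)).congr_deriv ?_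
  have : (n ! : ℝ) ≠ 0 := by exact_mod_cast n.factorial_ne_zero
  rw [Nat.factorial_succ, Nat.add_sub_cancel]
  push_cast
  field_simp

theorem hasDerivAt_pweight (t : ℝ) (n : ℤ) :
    HasDerivAt (fun t => pweight t n) (pweight t (n - 1)) t := by
  rcases lt_or_ge n 0 with h | h
  · simp only [pweight_of_neg _ h, pweight_of_neg t (show n - 1 < 0 by lia)]
    exact hasDerivAt_const _ _
  · obtain ⟨m, rfl⟩ := Int.eq_ofNat_of_zero_le h
    simp only [pweight_natCast]
    rcases m with _ | m
    · simpa [pweight] using hasDerivAt_const t (1 : ℝ)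
    · rw [show ((m + 1 : ℕ) : ℤ) - 1 = m by push_cast; ring, pweight_natCast]
      exact hasDerivAt_pow_succ_div_factorial m t

theorem pweight_zero (n : ℤ) : pweight 0 n = if n = 0 then 1 else 0 := by
  rcases lt_or_ge n 0 with h | h
  · rw [pweight_of_neg 0 h, if_neg h.ne]
  · obtain ⟨m, rfl⟩ := Int.eq_ofNat_of_zero_le h
    rcases m with _ | m
    · simp [pweight]
    · rw [pweight_natCast, zero_pow m.succ_ne_zero, zero_div, if_neg (by lia)]

theorem abs_pweight_le {t : ℝ} (ht : 0 ≤ t) (n : ℤ) : |pweight t n| ≤ Real.exp t := by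
  unfold pweight
  split_ifs
  · rw [abs_of_nonneg (by positivity)]
    exact Real.pow_div_factorial_le_exp t ht _
  · simpa using (Real.exp_pos t).le

variable {N : ℕ}

/-- The Karlin–McGregor determinant of `N` independent Poisson processes, `h`-transformed by the
Vandermonde determinant: the transition function of the noncolliding Poisson random walk. -/
noncomputable def kmTransition (t : ℝ) (x z : Weyl N) : ℝ :=
  vandermonde z / vandermonde x *
    (Real.exp (-(N * t)) * (Matrix.of fun i j => pweight t (z.1 j - x.1 i)).det)

theorem hasDerivAt_det_pweight (t : ℝ) (x z : Fin N → ℤ) :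
    HasDerivAt (fun t => (Matrix.of fun i j => pweight t (z j - x i)).det)
      (∑ i, (Matrix.of fun k j => pweight t (z j - bump x i k)).det) t := by
  have := hasDerivAt_det (M := fun t => Matrix.of fun i j => pweight t (z j - x i))
    (M' := Matrix.of fun i j => pweight t (z j - x i - 1)) (t := t)
    fun i j => hasDerivAt_pweight t _
  refine this.congr_deriv (Eq.symm (Finset.sum_congr rfl fun i _ => congrArg Matrix.det ?_))
  ext k j
  by_cases hk : k = i
  · subst hk
    rw [Matrix.updateRow_self, Matrix.of_apply, Matrix.of_apply, bump_apply_self, sub_sub]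
  · rw [Matrix.updateRow_ne hk, Matrix.of_apply, Matrix.of_apply, bump_apply_of_ne x hk]

theorem hasDerivAt_kmTransition (t : ℝ) (x z : Weyl N) :
    HasDerivAt (fun t => kmTransition t x z) (generator (fun y => kmTransition t y z) x) t := by
  classical
  have deriv_exp : HasDerivAt (fun t : ℝ => Real.exp (-(N * t)))
      (-(N : ℝ) * Real.exp (-(N * t))) t :=
    (((hasDerivAt_id' t).const_mul (N : ℝ)).fun_neg).exp.congr_deriv (by ring)
  refine ((deriv_exp.fun_mul (hasDerivAt_det_pweight t x.1 z.1)).const_mul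
    (vandermonde z / vandermonde x)).congr_deriv (Eq.symm ?_)
  rw [← sum_ite_strictMono_bump x
    (E := fun y => (Matrix.of fun k j => pweight t (z.1 j - y k)).det)
    fun y hy => det_of_comp_eq_zero (fun n j => pweight t (z.1 j - n)) hy]
  unfold generator kmTransition
  rw [mul_add, Finset.mul_sum, Finset.mul_sum]
  congr 1
  · ring
  · refine Finset.sum_congr rfl fun i _ => ?_
    split_ifs with h
    · have := (vandermonde_pos x).ne'
      have := (vandermonde_pos (⟨_, h⟩ : Weyl N)).ne'
      field_simp
    · simp

theorem kmTransition_zero_self (x : Weyl N) : kmTransition 0 x x = 1 := by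
  have : (Matrix.of fun i j => pweight 0 (x.1 j - x.1 i)) = 1 := by
    ext i j
    simp only [Matrix.of_apply, pweight_zero, Matrix.one_apply, sub_eq_zero,
      x.2.injective.eq_iff, eq_comm (a := j)]
  rw [kmTransition, this, Matrix.det_one, div_self (vandermonde_pos x).ne']
  simp

theorem exists_notMem_range_of_ne {x z : Weyl N} (h : x ≠ z) : ∃ j, z.1 j ∉ Set.range x.1 := by
  by_contra! hz
  refine h (Subtype.ext ((StrictMono.range_inj x.2 z.2).1 ?_))
  refine (Set.eq_of_subset_of_ncard_le (Set.range_subset_iff.2 hz) ?_ (Set.finite_range _)).symm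
  rw [← Set.image_univ, ← Set.image_univ, Set.ncard_image_of_injective _ x.2.injective,
    Set.ncard_image_of_injective _ z.2.injective]

theorem kmTransition_zero_of_ne {x z : Weyl N} (h : x ≠ z) : kmTransition 0 x z = 0 := by
  obtain ⟨j, hj⟩ := exists_notMem_range_of_ne h
  rw [kmTransition, Matrix.det_eq_zero_of_column_eq_zero j, mul_zero, mul_zero]
  intro i
  rw [Matrix.of_apply, pweight_zero, if_neg]
  exact fun heq => hj ⟨i, (sub_eq_zero.1 heq).symm⟩

theorem abs_kmTransition_le {t : ℝ} (ht : 0 ≤ t) (x z : Weyl N) :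
    |kmTransition t x z| ≤ vandermonde z * N ! := by
  have det_le : |(Matrix.of fun i j => pweight t (z.1 j - x.1 i)).det| ≤
      N ! * Real.exp (N * t) := by
    have := Matrix.det_le (A := Matrix.of fun i j => pweight t (z.1 j - x.1 i))
      (abv := AbsoluteValue.abs) (x := Real.exp t) fun i j => abs_pweight_le ht _
    rwa [Fintype.card_fin, ← Real.exp_nat_mul, nsmul_eq_mul] at this
  have hx := one_le_vandermonde x
  have hz := vandermonde_pos z
  rw [kmTransition, abs_mul, abs_mul, abs_of_pos (Real.exp_pos _),
    abs_of_pos (div_pos hz (vandermonde_pos x))]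
  calc _ ≤ vandermonde z / 1 * (Real.exp (-(N * t)) * (N ! * Real.exp (N * t))) := by gcongr
    _ = vandermonde z * N ! * (Real.exp (-(N * t)) * Real.exp (N * t)) := by ring
    _ = vandermonde z * N ! := by rw [← Real.exp_add, neg_add_cancel, Real.exp_zero, mul_one]

end KarlinMcGregor

section TransitionFunction

variable {S : Type*} {p : ℝ≥0 → S → S → ℝ} {q : S → S → ℝ}

theorem IsTransitionFunction.le_one (hp : IsTransitionFunction p) (t : ℝ≥0) (x y : S) :
    p t x y ≤ 1 := by
  simpa using sum_le_hasSum {y} (fun z _ => hp.nonneg t x z) (hp.hasSum_one t x)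

theorem IsTransitionFunction.zero_of_ne (hp : IsTransitionFunction p) {x y : S} (h : x ≠ y) :
    p 0 x y = 0 := by
  classical
  have := sum_le_hasSum {x, y} (fun z _ => hp.nonneg 0 x z) (hp.hasSum_one 0 x)
  rw [Finset.sum_pair h, hp.zero_self] at this
  linarith [hp.nonneg 0 x y]

theorem IsTransitionFunction.sum_zero (hp : IsTransitionFunction p) {x : S} {F : Finset S}
    (hx : x ∈ F) (f : S → ℝ) : ∑ y ∈ F, p 0 x y * f y = f x := by
  rw [Finset.sum_eq_single_of_mem x hx fun y _ hy => by rw [hp.zero_of_ne hy.symm, zero_mul],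
    hp.zero_self, one_mul]

theorem IsTransitionFunction.sum_le (hp : IsTransitionFunction p) (h t : ℝ≥0) (x z : S)
    (F : Finset S) : ∑ y ∈ F, p h x y * p t y z ≤ p (h + t) x z :=
  sum_le_hasSum F (fun _ _ => mul_nonneg (hp.nonneg _ _ _) (hp.nonneg _ _ _))
    (hp.chapman_kolmogorov h t x z)

theorem IsTransitionFunction.le_sum_add (hp : IsTransitionFunction p) (h t : ℝ≥0) (x z : S)
    (F : Finset S) :
    p (h + t) x z ≤ ∑ y ∈ F, p h x y * p t y z + (1 - ∑ y ∈ F, p h x y) := by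
  have := sum_le_hasSum F
    (fun y _ => sub_nonneg.2 (mul_le_of_le_one_right (hp.nonneg h x y) (hp.le_one t y z)))
    ((hp.hasSum_one h x).sub (hp.chapman_kolmogorov h t x z))
  rw [Finset.sum_sub_distrib] at this
  linarith

theorem IsTransitionFunction.abs_sub_le (hp : IsTransitionFunction p) (h t : ℝ≥0) (x z : S) :
    |p (h + t) x z - p t x z| ≤ 1 - p h x x := by
  have lower := hp.sum_le h t x z {x}
  have upper := hp.le_sum_add h t x z {x}
  simp only [Finset.sum_singleton] at lower upper
  have := hp.le_one t x z
  have := hp.nonneg t x z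
  have := hp.le_one h x x
  rw [abs_le]
  constructor <;> nlinarith

theorem HasJumpRates.tendsto_zero (hq : HasJumpRates p q) (x y : S) :
    Tendsto (fun h => p h x y) (𝓝 0) (𝓝 (p 0 x y)) := by
  have coe_tendsto : Tendsto (fun h : ℝ≥0 => (h : ℝ)) (𝓝[>] 0) (𝓝 0) :=
    tendsto_nhdsWithin_of_tendsto_nhds (NNReal.continuous_coe.tendsto 0)
  have lim := ((hq x y).mul coe_tendsto).add_const (p 0 x y)
  rw [mul_zero, zero_add] at lim
  have right : ContinuousWithinAt (fun h => p h x y) (Set.Ioi 0) 0 := by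
    refine lim.congr' ?_
    filter_upwards [self_mem_nhdsWithin] with h hh
    have : (h : ℝ) ≠ 0 := by exact_mod_cast (ne_of_gt hh)
    rw [div_mul_cancel₀ _ this, sub_add_cancel]
  have Ici_zero : Set.Ici (0 : ℝ≥0) = Set.univ := Set.Ici_bot
  rwa [continuousWithinAt_Ioi_iff_Ici, Ici_zero, continuousWithinAt_univ] at right

theorem IsTransitionFunction.continuous (hp : IsTransitionFunction p) (hq : HasJumpRates p q)
    (x z : S) : Continuous fun t => p t x z := by
  refine continuous_iff_continuousAt.2 fun t => ?_
  -- `|s - t|`, written with truncated subtraction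
  have gap_tendsto : Tendsto (fun s : ℝ≥0 => (s - t) + (t - s)) (𝓝 t) (𝓝 0) := by
    have : Continuous fun s : ℝ≥0 => (s - t) + (t - s) := by fun_prop
    simpa using this.tendsto t
  have modulus := ((hq.tendsto_zero x x).comp gap_tendsto).const_sub 1
  rw [hp.zero_self, sub_self] at modulus
  refine tendsto_iff_dist_tendsto_zero.2 (squeeze_zero (fun _ => dist_nonneg) (fun s => ?_) modulus)
  simp only [Function.comp, Real.dist_eq]
  rcases le_total s t with h | h
  · rw [tsub_eq_zero_of_le h, zero_add, abs_sub_comm]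
    simpa only [tsub_add_cancel_of_le h] using hp.abs_sub_le (t - s) s x z
  · rw [tsub_eq_zero_of_le h, add_zero]
    simpa only [tsub_add_cancel_of_le h] using hp.abs_sub_le (s - t) t x z

theorem IsTransitionFunction.tendsto_sum_slope (hp : IsTransitionFunction p)
    (hq : HasJumpRates p q) {x : S} {F : Finset S} (hx : x ∈ F) (f : S → ℝ) :
    Tendsto (fun h : ℝ≥0 => (∑ y ∈ F, p h x y * f y - f x) / (h : ℝ)) (𝓝[>] 0)
      (𝓝 (∑ y ∈ F, q x y * f y)) := by
  refine (tendsto_finsetSum F fun y _ => (hq x y).mul_const (f y)).congr fun h => ?_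
  rw [← hp.sum_zero hx f, ← Finset.sum_sub_distrib, Finset.sum_div]
  exact Finset.sum_congr rfl fun y _ => by ring

/-- The Kolmogorov backward equation. -/
theorem IsTransitionFunction.tendsto_slope (hp : IsTransitionFunction p) (hq : HasJumpRates p q)
    {x : S} {F : Finset S} (hx : x ∈ F) (conservative : ∑ y ∈ F, q x y = 0) (t : ℝ≥0) (z : S) :
    Tendsto (fun h : ℝ≥0 => (p (h + t) x z - p t x z) / (h : ℝ)) (𝓝[>] 0)
      (𝓝 (∑ y ∈ F, q x y * p t y z)) := by
  have lower := hp.tendsto_sum_slope hq hx fun y => p t y z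
  have upper := lower.sub (hp.tendsto_sum_slope hq hx fun _ => 1)
  simp only [mul_one, conservative, sub_zero, ← sub_div] at upper
  refine tendsto_of_tendsto_of_tendsto_of_le_of_le lower upper (fun h => ?_) fun h => ?_
  · exact div_le_div_of_nonneg_right (sub_le_sub_right (hp.sum_le h t x z F) _) h.2
  · refine div_le_div_of_nonneg_right ?_ h.2
    linarith [hp.le_sum_add h t x z F]

theorem eq_zero_of_hasDerivWithinAt_of_bounded {L : (S → ℝ) → S → ℝ} {C B : ℝ} {D : ℝ → S → ℝ}
    (hL : ∀ f B, (∀ y, |f y| ≤ B) → ∀ y, |L f y| ≤ C * B)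
    (hcont : ∀ y, ContinuousOn (fun s => D s y) (Set.Ici 0))
    (hderiv : ∀ s, 0 ≤ s → ∀ y, HasDerivWithinAt (fun s => D s y) (L (D s) y) (Set.Ici s) s)
    (hzero : ∀ y, D 0 y = 0) (hbound : ∀ s, 0 ≤ s → ∀ y, |D s y| ≤ B) {t : ℝ} (ht : 0 ≤ t)
    (x : S) : D t x = 0 := by
  have picard (n : ℕ) : ∀ s, 0 ≤ s → ∀ y, |D s y| ≤ B * ((C * s) ^ n / n !) := by
    induction n with
    | zero => simpa using hbound
    | succ n ih =>
      intro s hs y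
      have deriv_majorant (r : ℝ) : HasDerivAt (fun r : ℝ => B * ((C * r) ^ (n + 1) / (n + 1)!))
          (C * (B * ((C * r) ^ n / n !))) r :=
        (((hasDerivAt_pow_succ_div_factorial n (C * r)).comp r
          ((hasDerivAt_id' r).const_mul C)).const_mul B).congr_deriv (by ring)
      exact image_norm_le_of_norm_deriv_right_le_deriv_boundary (f := fun s => D s y)
        ((hcont y).mono Set.Icc_subset_Ici_self) (fun r hr => hderiv r hr.1 y) (by simp [hzero])
        deriv_majorant (fun r hr => hL _ _ (ih r hr.1) y) ⟨hs, le_rfl⟩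
  have lim := (FloorSemiring.tendsto_pow_div_factorial_atTop (C * t)).const_mul B
  rw [mul_zero] at lim
  exact abs_nonpos_iff.1 (ge_of_tendsto' lim fun n => picard n t ht x)

variable {N : ℕ} {p : ℝ≥0 → Weyl N → Weyl N → ℝ}

theorem tendsto_slope_transition (hp : IsTransitionFunction p) (hq : HasJumpRates p poissonRate)
    (t : ℝ≥0) (x z : Weyl N) :
    Tendsto (fun h : ℝ≥0 => (p (h + t) x z - p t x z) / (h : ℝ)) (𝓝[>] 0)
      (𝓝 (generator (fun y => p t y z) x)) := by
  obtain ⟨F, hx, sum_rate⟩ := exists_sum_rate_eq_generator x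
  rw [← sum_rate]
  refine hp.tendsto_slope hq hx ?_ t z
  simpa only [mul_one, generator_one] using sum_rate fun _ => 1

theorem hasDerivWithinAt_transition (hp : IsTransitionFunction p)
    (hq : HasJumpRates p poissonRate) {t : ℝ} (ht : 0 ≤ t) (x z : Weyl N) :
    HasDerivWithinAt (fun s : ℝ => p s.toNNReal x z)
      (generator (fun y => p t.toNNReal y z) x) (Set.Ici t) t := by
  rw [← hasDerivWithinAt_Ioi_iff_Ici, hasDerivWithinAt_iff_tendsto_slope' (by simp)]
  have increment_tendsto : Tendsto (fun s : ℝ => (s - t).toNNReal) (𝓝[>] t) (𝓝[>] 0) := by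
    refine tendsto_nhdsWithin_iff.2 ⟨tendsto_nhdsWithin_of_tendsto_nhds ?_, ?_⟩
    · have : Continuous fun s : ℝ => (s - t).toNNReal := by fun_prop
      simpa using this.tendsto t
    · filter_upwards [self_mem_nhdsWithin] with s hs
      exact Real.toNNReal_pos.2 (sub_pos.2 hs)
  refine ((tendsto_slope_transition hp hq t.toNNReal x z).comp increment_tendsto).congr' ?_
  filter_upwards [self_mem_nhdsWithin] with s hs
  have nonneg : 0 ≤ s - t := (sub_pos.2 hs).le
  simp only [Function.comp, slope_def_field]
  rw [Real.coe_toNNReal _ nonneg, ← Real.toNNReal_add nonneg ht, sub_add_cancel]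

theorem transition_eq_kmTransition (hp : IsTransitionFunction p)
    (hq : HasJumpRates p poissonRate) (t : ℝ≥0) (x z : Weyl N) :
    p t x z = kmTransition t x z := by
  set D : ℝ → Weyl N → ℝ := fun s y => p s.toNNReal y z - kmTransition s y z with hD
  suffices D t x = 0 by simpa only [hD, Real.toNNReal_coe, sub_eq_zero] using this
  refine eq_zero_of_hasDerivWithinAt_of_bounded (L := generator) (C := 2 * N)
    (B := 1 + vandermonde z * N !) (fun f B hf y => abs_generator_le hf y)
    (fun y => ?_) (fun s hs y => ?_) (fun y => ?_) (fun s hs y => ?_) t.2 x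
  · exact ((hp.continuous hq y z).comp continuous_real_toNNReal).continuousOn.sub
      fun s _ => (hasDerivAt_kmTransition s y z).continuousAt.continuousWithinAt
  · rw [hD, generator_sub]
    exact (hasDerivWithinAt_transition hp hq hs y z).fun_sub
      (hasDerivAt_kmTransition s y z).hasDerivWithinAt
  · simp only [hD, Real.toNNReal_zero, sub_eq_zero]
    by_cases h : y = z
    · rw [h, hp.zero_self, kmTransition_zero_self]
    · rw [hp.zero_of_ne h, kmTransition_zero_of_ne h]
  · refine (abs_sub _ _).trans (add_le_add ?_ (abs_kmTransition_le hs y z))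
    rw [abs_of_nonneg (hp.nonneg _ _ _)]
    exact hp.le_one _ _ _

end TransitionFunction

section BackwardEvolution

variable {N : ℕ} {ι : Type*} [Fintype ι]

theorem prod_one_add_ite_of_subsingleton {κ : Type*} (s : Finset κ) (P : κ → Prop)
    [DecidablePred P] [Decidable (∃ i ∈ s, P i)] (u : ℝ)
    (unique : ∀ i ∈ s, ∀ j ∈ s, P i → P j → i = j) :
    ∏ i ∈ s, (1 + u * if P i then 1 else 0) = 1 + u * if ∃ i ∈ s, P i then 1 else 0 := by
  split_ifs with hex
  · obtain ⟨i, hi, hPi⟩ := hex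
    rw [Finset.prod_eq_single_of_mem i hi, if_pos hPi]
    intro j hj hji
    rw [if_neg fun hPj => hji (unique j hj i hi hPj hPi), mul_zero, add_zero]
  · push Not at hex
    rw [mul_zero, add_zero]
    refine Finset.prod_eq_one fun i hi => ?_
    rw [if_neg (hex i hi), mul_zero, add_zero]

theorem expSummable_sum_expShift_single {κ : Type*} (s : Finset κ) (c t : κ → ℝ) (y : κ → ℤ) :
    ExpSummable fun x => ∑ β ∈ s, c β * expShift (t β) (Pi.single (y β) 1) x :=
  ExpSummable.sum fun β _ => ((expSummable_single (y β) 1).expShift _).const_mul _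

theorem expSummable_sum_single {κ : Type*} (s : Finset κ) (c : κ → ℝ) (y : κ → ℤ) :
    ExpSummable fun x => ∑ β ∈ s, c β * (Pi.single (y β) 1 : ℤ → ℝ) x :=
  ExpSummable.sum fun β _ => (expSummable_single (y β) 1).const_mul _

theorem filter_lt_eq_union {T : Type*} [LinearOrder T] {τ : ι → T} {s t : T} (hst : s < t)
    (hgap : ∀ α, s < τ α → t ≤ τ α) [DecidableEq ι] :
    (Finset.univ.filter fun β => s < τ β) =
      (Finset.univ.filter fun β => t < τ β) ∪ Finset.univ.filter fun β => τ β = t := by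
  ext β
  simp only [Finset.mem_filter, Finset.mem_univ, true_and, Finset.mem_union]
  refine ⟨fun h => (hgap β h).lt_or_eq.imp_right Eq.symm, ?_⟩
  rintro (h | rfl)
  exacts [hst.trans h, hst]

theorem disjoint_filter_lt_filter_eq {T : Type*} [LinearOrder T] (τ : ι → T) (t : T) :
    Disjoint (Finset.univ.filter fun β => t < τ β) (Finset.univ.filter fun β => τ β = t) :=
  Finset.disjoint_filter.2 fun _ _ hlt heq => hlt.ne' heq

/-- The product of the one-particle weights `1 + u 1_{y_β}` at the time `t`. -/
noncomputable def timeWeight (τ : ι → ℝ≥0) (y : ι → ℤ) (u : ℝ) (t : ℝ≥0) (x : ℤ) : ℝ :=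
  ∏ β with τ β = t, (1 + u * (Pi.single (y β) 1 : ℤ → ℝ) x)

open Classical in
theorem prod_timeWeight (τ : ι → ℝ≥0) (y : ι → ℤ) (u : ℝ) (t : ℝ≥0) (c : Weyl N) :
    ∏ j, timeWeight τ y u t (c.1 j) =
      ∏ β with τ β = t, (1 + u * if ∃ j, c.1 j = y β then 1 else 0) := by
  simp only [timeWeight, Pi.single_apply]
  rw [Finset.prod_comm]
  refine Finset.prod_congr rfl fun β _ => ?_
  rw [prod_one_add_ite_of_subsingleton _ _ _ fun i _ j _ hi hj =>
    c.2.injective (hi.trans hj.symm)]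
  simp

/-- The matrix `Φ` of the transition weights between the space-time points `(τ_α, y_α)`,
directed forward in time. -/
noncomputable def forwardMatrix (τ : ι → ℝ≥0) (y : ι → ℤ) : Matrix ι ι ℝ :=
  Matrix.of fun β α => if τ β < τ α then pweight (τ α - τ β) (y α - y β) else 0

/-- The matrix `Ψ` of the backward evolved Lagrange polynomials at the space-time points. -/
noncomputable def terminalMatrix (a : Weyl N) (τ : ι → ℝ≥0) (y : ι → ℤ) :
    Matrix ι (Fin N) ℝ :=
  Matrix.of fun β r => expShift (-τ β) (fun n => (lagrangeBasis a r).eval (n : ℝ)) (y β)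

/-- The matrix `I` of the transition weights from the initial points `a_r` to the space-time
points. -/
noncomputable def initialMatrix (a : Weyl N) (τ : ι → ℝ≥0) (y : ι → ℤ) :
    Matrix (Fin N) ι ℝ :=
  Matrix.of fun r α => pweight (τ α) (y α - a.1 r)

theorem det_one_sub_forwardMatrix [DecidableEq ι] (τ : ι → ℝ≥0) (y : ι → ℤ) (u : ℝ) :
    (1 - u • forwardMatrix τ y).det = 1 := by
  have triangular : Matrix.BlockTriangular (1 - u • forwardMatrix τ y) τ := by
    intro i j hij
    have hne : i ≠ j := fun h => by subst h; exact lt_irrefl _ hij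
    simp [forwardMatrix, Matrix.one_apply_ne hne, hij.not_gt]
  have diagonal_block (t : ℝ≥0) : (1 - u • forwardMatrix τ y).toSquareBlock τ t = 1 := by
    ext i j
    have same_time : τ i.1 = τ j.1 := i.2.trans j.2.symm
    simp [Matrix.toSquareBlock_def, forwardMatrix, same_time, Matrix.one_apply, Subtype.ext_iff]
  rw [triangular.det]
  exact Finset.prod_eq_one fun t _ => by rw [diagonal_block, Matrix.det_one]

variable [DecidableEq ι]

/-- The solution `G` of `(1 - u Φ) G = Ψ`, with `Φ` the forward and `Ψ` the terminal matrix. -/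
noncomputable def resolvent (a : Weyl N) (τ : ι → ℝ≥0) (y : ι → ℤ) (u : ℝ) :
    Matrix ι (Fin N) ℝ :=
  (1 - u • forwardMatrix τ y)⁻¹ * terminalMatrix a τ y

theorem one_sub_forwardMatrix_mul_resolvent (a : Weyl N) (τ : ι → ℝ≥0) (y : ι → ℤ) (u : ℝ) :
    (1 - u • forwardMatrix τ y) * resolvent a τ y u = terminalMatrix a τ y :=
  Matrix.mul_nonsing_inv_cancel_left _ _ (by
    rw [det_one_sub_forwardMatrix]; exact isUnit_one)

theorem resolvent_apply (a : Weyl N) (τ : ι → ℝ≥0) (y : ι → ℤ) (u : ℝ) (β : ι) (r : Fin N) :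
    resolvent a τ y u β r = terminalMatrix a τ y β r +
      u * ∑ α, forwardMatrix τ y β α * resolvent a τ y u α r := by
  rw [← one_sub_forwardMatrix_mul_resolvent a τ y u, Matrix.sub_mul, Matrix.one_mul,
    Matrix.smul_mul, Matrix.sub_apply, Matrix.smul_apply, Matrix.mul_apply, smul_eq_mul]
  ring

/-- The one-particle functions which, propagated backward in time from the Lagrange polynomials
through the weights `1 + u 1_{y_α}` at the times `τ_α`, are obtained just after the time `s`. -/
noncomputable def backward (a : Weyl N) (τ : ι → ℝ≥0) (y : ι → ℤ) (u : ℝ) (s : ℝ≥0)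
    (r : Fin N) (x : ℤ) : ℝ :=
  expShift (-s) (fun n => (lagrangeBasis a r).eval (n : ℝ)) x +
    ∑ β with s < τ β, u * resolvent a τ y u β r * expShift (τ β - s) (Pi.single (y β) 1) x

theorem expSummable_backward (a : Weyl N) (τ : ι → ℝ≥0) (y : ι → ℤ) (u : ℝ) (s : ℝ≥0)
    (r : Fin N) : ExpSummable (backward a τ y u s r) :=
  ((expSummable_lagrangeBasis a r).expShift _).add (expSummable_sum_expShift_single _ _ _ _)

theorem backward_self (a : Weyl N) (τ : ι → ℝ≥0) (y : ι → ℤ) (u : ℝ) (β : ι) (r : Fin N) :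
    backward a τ y u (τ β) r (y β) = resolvent a τ y u β r := by
  rw [resolvent_apply, backward, Finset.mul_sum, Finset.sum_filter]
  congr 1
  refine Finset.sum_congr rfl fun α _ => ?_
  rw [expShift_single, forwardMatrix, Matrix.of_apply]
  split_ifs
  · ring
  · simp

theorem timeWeight_mul_backward (a : Weyl N) {τ : ι → ℝ≥0} {y : ι → ℤ}
    (hinj : Function.Injective fun i => (τ i, y i)) (u : ℝ) (t : ℝ≥0) (r : Fin N) (x : ℤ) :
    timeWeight τ y u t x * backward a τ y u t r x = backward a τ y u t r x +
      ∑ β with τ β = t, u * resolvent a τ y u β r * (Pi.single (y β) 1 : ℤ → ℝ) x := by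
  have unique : ∀ α ∈ Finset.univ.filter fun β => τ β = t,
      ∀ β ∈ Finset.univ.filter fun β => τ β = t, x = y α → x = y β → α = β :=
    fun α hα β hβ hxα hxβ => hinj (Prod.ext
      ((Finset.mem_filter.1 hα).2.trans (Finset.mem_filter.1 hβ).2.symm) (hxα.symm.trans hxβ))
  simp only [timeWeight, Pi.single_apply]
  rw [prod_one_add_ite_of_subsingleton _ _ _ unique]
  split_ifs with hex
  · obtain ⟨β, hβ, hx⟩ := hex
    rw [Finset.sum_eq_single_of_mem β hβ fun α hα hne => by
      rw [if_neg fun hxα => hne (unique α hα β hβ hxα hx), mul_zero], if_pos hx,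
      ← backward_self, (Finset.mem_filter.1 hβ).2, hx]
    ring
  · push Not at hex
    rw [Finset.sum_eq_zero fun β hβ => by rw [if_neg (hex β hβ), mul_zero]]
    ring

theorem expSummable_timeWeight_mul_backward (a : Weyl N) {τ : ι → ℝ≥0} {y : ι → ℤ}
    (hinj : Function.Injective fun i => (τ i, y i)) (u : ℝ) (t : ℝ≥0) (r : Fin N) :
    ExpSummable fun x => timeWeight τ y u t x * backward a τ y u t r x := by
  simp_rw [timeWeight_mul_backward a hinj]
  exact (expSummable_backward a τ y u t r).add (expSummable_sum_single _ _ _)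

theorem expShift_backward (a : Weyl N) (τ : ι → ℝ≥0) (y : ι → ℤ) (u : ℝ) (s t : ℝ≥0)
    (r : Fin N) (x : ℤ) :
    expShift (t - s) (backward a τ y u t r) x =
      expShift (-s) (fun n => (lagrangeBasis a r).eval (n : ℝ)) x +
        ∑ β with t < τ β, u * resolvent a τ y u β r *
          expShift (τ β - s) (Pi.single (y β) 1) x := by
  unfold backward
  rw [expShift_add ((expSummable_lagrangeBasis a r).expShift _)
      (expSummable_sum_expShift_single _ _ _ _),
    expShift_sum fun β _ => ((expSummable_single (y β) 1).expShift _).const_mul _,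
    expShift_expShift (expSummable_lagrangeBasis a r)]
  simp_rw [expShift_const_mul, expShift_expShift (expSummable_single _ _)]
  ring_nf

theorem expShift_timeWeight_mul_backward (a : Weyl N) {τ : ι → ℝ≥0} {y : ι → ℤ}
    (hinj : Function.Injective fun i => (τ i, y i)) (u : ℝ) {s t : ℝ≥0} (hst : s < t)
    (hgap : ∀ α, s < τ α → t ≤ τ α) (r : Fin N) (x : ℤ) :
    expShift (t - s) (fun x => timeWeight τ y u t x * backward a τ y u t r x) x =
      backward a τ y u s r x := by
  simp_rw [timeWeight_mul_backward a hinj]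
  rw [expShift_add (expSummable_backward a τ y u t r) (expSummable_sum_single _ _ _),
    expShift_sum fun β _ => (expSummable_single (y β) 1).const_mul _, expShift_backward,
    backward, filter_lt_eq_union hst hgap,
    Finset.sum_union (disjoint_filter_lt_filter_eq τ t), add_assoc]
  congr 2
  refine Finset.sum_congr rfl fun β hβ => ?_
  rw [expShift_const_mul, (Finset.mem_filter.1 hβ).2]

/-- The conditional expectation of the product of the weights at the space-time points with
`τ_α > s`, given the position `b` at the time `s`. -/
noncomputable def condWeight (a : Weyl N) (τ : ι → ℝ≥0) (y : ι → ℤ) (u : ℝ) (s : ℝ≥0)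
    (b : Weyl N) : ℝ :=
  Real.exp (N * s) * (vandermonde a / vandermonde b) *
    (Matrix.of fun i r => backward a τ y u s r (b.1 i)).det

theorem condWeight_eq_one (a : Weyl N) {τ : ι → ℝ≥0} (y : ι → ℤ) (u : ℝ) {s : ℝ≥0}
    (hs : ∀ α, ¬ s < τ α) (b : Weyl N) : condWeight a τ y u s b = 1 := by
  have no_later_time : (Finset.univ.filter fun β => s < τ β) = ∅ :=
    Finset.filter_eq_empty_iff.2 fun β _ => hs β
  simp only [condWeight, backward, no_later_time, Finset.sum_empty, add_zero,
    det_expShift_lagrangeBasis]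
  calc _ = Real.exp (N * s) * Real.exp (N * -s) *
        ((vandermonde a / vandermonde b) * (vandermonde b / vandermonde a)) := by ring
    _ = 1 := by
      rw [← Real.exp_add, div_mul_div_cancel₀ (vandermonde_pos b).ne',
        div_self (vandermonde_pos a).ne']
      simp

/-- The Cauchy–Binet formula propagates the one-particle identity
`expShift_timeWeight_mul_backward` to `N` particles. -/
theorem hasSum_kmTransition_mul_condWeight (a : Weyl N) {τ : ι → ℝ≥0} {y : ι → ℤ}
    (hinj : Function.Injective fun i => (τ i, y i)) (u : ℝ) {s t : ℝ≥0} (hst : s < t)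
    (hgap : ∀ α, s < τ α → t ≤ τ α) (b : Weyl N) :
    HasSum (fun c : Weyl N => kmTransition (t - s) b c *
      ((∏ j, timeWeight τ y u t (c.1 j)) * condWeight a τ y u t c)) (condWeight a τ y u s b) := by
  have one_particle (i r) : HasSum (fun x : ℤ => pweight (t - s) (x - b.1 i) *
      (timeWeight τ y u t x * backward a τ y u t r x)) (backward a τ y u s r (b.1 i)) := by
    rw [← expShift_timeWeight_mul_backward a hinj u hst hgap r]
    exact (expSummable_timeWeight_mul_backward a hinj u t r).hasSum_pweight _ _
  have cauchy_binet := hasSum_det_mul_det (A := fun i x => pweight (t - s) (x - b.1 i))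
    (B := fun x r => timeWeight τ y u t x * backward a τ y u t r x)
    fun i r => (one_particle i r).summable
  simp_rw [fun i r => (one_particle i r).tsum_eq] at cauchy_binet
  refine (cauchy_binet.mul_left (Real.exp (N * s) * (vandermonde a / vandermonde b))).congr_fun
    fun c => ?_
  have pull_out_weights := Matrix.det_mul_column (fun j => timeWeight τ y u t (c.1 j))
    (Matrix.of fun j r => backward a τ y u t r (c.1 j))
  simp only [Matrix.of_apply] at pull_out_weights
  have exp_split : Real.exp (N * (s : ℝ)) =
      Real.exp (-(N * ((t : ℝ) - s))) * Real.exp (N * t) := by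
    rw [← Real.exp_add]; congr 1; ring
  have hb := (vandermonde_pos b).ne'
  have hc := (vandermonde_pos c).ne'
  rw [pull_out_weights, kmTransition, condWeight, exp_split]
  field_simp

end BackwardEvolution

section FredholmDeterminant

variable {N : ℕ} {ι : Type*}

theorem transpose_biorthKernel_eq (a : Weyl N) (τ : ι → ℝ≥0) (y : ι → ℤ) :
    (Matrix.of fun α β => biorthKernel a (τ α) (y α) (τ β) (y β)).transpose =
      terminalMatrix a τ y * initialMatrix a τ y - forwardMatrix τ y := by
  ext β α
  simp only [Matrix.transpose_apply, Matrix.of_apply, Matrix.sub_apply, Matrix.mul_apply,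
    terminalMatrix, initialMatrix, forwardMatrix, biorthKernel, NNReal.coe_lt_coe, mul_comm]
  ring

variable [Fintype ι] [DecidableEq ι]

theorem of_backward_zero (a : Weyl N) {τ : ι → ℝ≥0} (hτ : ∀ i, 0 < τ i) (y : ι → ℤ) (u : ℝ) :
    (Matrix.of fun i r => backward a τ y u 0 r (a.1 i)) =
      1 + (u • initialMatrix a τ y) * resolvent a τ y u := by
  ext i r
  rw [Matrix.of_apply, Matrix.add_apply, Matrix.mul_apply, backward,
    Finset.filter_true_of_mem fun β _ => hτ β]
  congr 1
  · rw [NNReal.coe_zero, neg_zero, expShift, tsum_eq_single 0 fun n hn => by simp [hn]]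
    simp [lagrangeBasis_eval_node]
  · refine Finset.sum_congr rfl fun β _ => ?_
    rw [expShift_single, initialMatrix, Matrix.smul_apply, Matrix.of_apply, NNReal.coe_zero,
      sub_zero, smul_eq_mul]
    ring

theorem condWeight_zero (a : Weyl N) {τ : ι → ℝ≥0} (hτ : ∀ i, 0 < τ i) (y : ι → ℤ) (u : ℝ) :
    condWeight a τ y u 0 a = (1 + u • Matrix.of fun α β =>
      biorthKernel a (τ α) (y α) (τ β) (y β)).det := by
  have factor : (1 - u • forwardMatrix τ y) *
      (1 + resolvent a τ y u * (u • initialMatrix a τ y)) =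
        (1 + u • Matrix.of fun α β =>
          biorthKernel a (τ α) (y α) (τ β) (y β)).transpose := by
    rw [Matrix.mul_add, ← Matrix.mul_assoc, one_sub_forwardMatrix_mul_resolvent,
      Matrix.transpose_add, Matrix.transpose_smul, transpose_biorthKernel_eq, Matrix.mul_smul,
      Matrix.transpose_one, Matrix.mul_one, smul_sub]
    abel
  rw [condWeight, of_backward_zero a hτ, Matrix.det_one_add_mul_comm,
    div_self (vandermonde_pos a).ne', ← Matrix.det_transpose (1 + u • _), ← factor,
    Matrix.det_mul, det_one_sub_forwardMatrix]
  simp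

end FredholmDeterminant

section Inclusion

variable {Ω ι : Type*} [MeasurableSpace Ω] {μ : Measure Ω} [IsFiniteMeasure μ] {A : ι → Set Ω}

theorem integrable_prod_one_add_indicator (hA : ∀ α, MeasurableSet (A α)) (u : ℝ)
    (s : Finset ι) : Integrable (fun ω => ∏ α ∈ s, (1 + u * (A α).indicator 1 ω)) μ := by
  refine Integrable.of_bound (C := ∏ α ∈ s, (1 + |u|)) ?_ (Eventually.of_forall fun ω => ?_)
  · exact (Finset.measurable_fun_prod s fun α _ => measurable_const.add
      ((measurable_one.indicator (hA α)).const_mul u)).aestronglyMeasurable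
  · rw [norm_prod]
    refine Finset.prod_le_prod (fun _ _ => norm_nonneg _) fun α _ => ?_
    refine (norm_add_le _ _).trans ?_
    rw [norm_one, norm_mul, Real.norm_eq_abs]
    gcongr
    refine mul_le_of_le_one_right (abs_nonneg u) ?_
    refine (norm_indicator_le_norm_self _ _).trans ?_
    simp

variable [Fintype ι]

theorem tendsto_integral_prod_add_indicator (hA : ∀ α, MeasurableSet (A α)) :
    Tendsto (fun v : ℝ => ∫ ω, ∏ α, (v + (A α).indicator 1 ω) ∂μ) (𝓝[>] 0)
      (𝓝 (μ.real (⋂ α, A α))) := by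
  rw [← integral_indicator_one (MeasurableSet.iInter hA)]
  refine tendsto_integral_filter_of_dominated_convergence (fun _ => ∏ _ : ι, 2) ?_ ?_
    (integrable_const _) (Eventually.of_forall fun ω => ?_)
  · exact Eventually.of_forall fun v => (Finset.measurable_fun_prod _ fun α _ =>
      measurable_const.add (measurable_one.indicator (hA α))).aestronglyMeasurable
  · filter_upwards [Ioo_mem_nhdsGT (zero_lt_one' ℝ)] with v hv
    refine Eventually.of_forall fun ω => ?_
    rw [norm_prod]
    refine Finset.prod_le_prod (fun _ _ => norm_nonneg _) fun α _ => ?_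
    rw [Real.norm_eq_abs, abs_le]
    rcases Set.indicator_eq_zero_or_self (A α) (1 : Ω → ℝ) ω with h | h <;>
      simp only [h, Pi.one_apply] <;> constructor <;> linarith [hv.1, hv.2]
  · have limit : (⋂ α, A α).indicator (1 : Ω → ℝ) ω = ∏ α, (0 + (A α).indicator 1 ω) := by
      simp [prod_indicator_const_apply]
    rw [limit]
    exact tendsto_nhdsWithin_of_tendsto_nhds
      (tendsto_finsetProd _ fun α _ => tendsto_id.add_const _)

/-- The probability of the intersection is the leading coefficient in `u` of the integral. -/
theorem measureReal_iInter_eq_det [DecidableEq ι] (hA : ∀ α, MeasurableSet (A α))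
    {M : Matrix ι ι ℝ}
    (h : ∀ u : ℝ, ∫ ω, ∏ α, (1 + u * (A α).indicator 1 ω) ∂μ = (1 + u • M).det) :
    μ.real (⋂ α, A α) = M.det := by
  refine tendsto_nhds_unique (tendsto_integral_prod_add_indicator hA) ?_
  have continuous_det : Continuous fun v : ℝ => (v • (1 : Matrix ι ι ℝ) + M).det :=
    Continuous.matrix_det (by fun_prop)
  have det_limit := continuous_det.tendsto 0
  rw [zero_smul, zero_add] at det_limit
  refine (tendsto_nhdsWithin_of_tendsto_nhds det_limit).congr' ?_
  filter_upwards [self_mem_nhdsWithin] with v (hv : 0 < v)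
  have rescale : v • (1 : Matrix ι ι ℝ) + M = v • (1 + v⁻¹ • M) := by
    rw [smul_add, smul_smul, mul_inv_cancel₀ hv.ne', one_smul]
  rw [rescale, Matrix.det_smul, ← h, ← integral_const_mul]
  congr 1 with ω
  rw [← Finset.card_univ, ← Finset.prod_const, ← Finset.prod_mul_distrib]
  refine Finset.prod_congr rfl fun α _ => ?_
  field_simp

end Inclusion

section MarkovChain

variable {Ω S : Type*} {X : ℝ≥0 → Ω → S}

/-- The event that `X` visits the states `x i` at the times `t i`. -/
def pathEvent {n : ℕ} (X : ℝ≥0 → Ω → S) (t : Fin n → ℝ≥0) (x : Fin n → S) : Set Ω :=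
  {ω | ∀ i, X (t i) ω = x i}

theorem pathEvent_snoc {n : ℕ} (t : Fin n → ℝ≥0) (x : Fin n → S) (t' : ℝ≥0) (c : S) :
    pathEvent (n := n + 1) X (Fin.snoc t t') (Fin.snoc x c) =
      {ω | (∀ i, X (t i) ω = x i) ∧ X t' ω = c} := by
  ext ω
  simp only [pathEvent, Set.mem_ofPred_eq, Fin.forall_fin_succ', Fin.snoc_castSucc, Fin.snoc_last]

theorem monotone_snoc {T : Type*} [Preorder T] {n : ℕ} {t : Fin (n + 1) → T} (ht : Monotone t)
    {t' : T} (h : t (Fin.last n) ≤ t') : Monotone (Fin.snoc t t' : Fin (n + 2) → T) := by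
  refine Fin.monotone_iff_le_succ.2 fun i => ?_
  induction i using Fin.lastCases with
  | last => rw [Fin.succ_last, Fin.snoc_last, Fin.snoc_castSucc]; exact h
  | cast i =>
    rw [Fin.succ_castSucc, Fin.snoc_castSucc, Fin.snoc_castSucc]
    exact ht i.castSucc_lt_succ.le

variable [MeasurableSpace Ω] {μ : Measure Ω} {p : ℝ≥0 → S → S → ℝ} {a : S}

theorem IsMarkovChain.measurableSet_mem [Countable S] (hX : IsMarkovChain μ X p a) (t : ℝ≥0)
    (A : Set S) : MeasurableSet {ω | X t ω ∈ A} := by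
  have union_of_points : {ω | X t ω ∈ A} = ⋃ x ∈ A, {ω | X t ω = x} := by ext; simp
  rw [union_of_points]
  exact MeasurableSet.biUnion A.to_countable fun x _ => hX.measurableSet t x

theorem IsMarkovChain.measurableSet_pathEvent (hX : IsMarkovChain μ X p a) {n : ℕ}
    (t : Fin n → ℝ≥0) (x : Fin n → S) : MeasurableSet (pathEvent X t x) := by
  rw [pathEvent, Set.ofPred_forall]
  exact MeasurableSet.iInter fun i => hX.measurableSet _ _

theorem IsMarkovChain.measureReal_pathEvent_snoc (hX : IsMarkovChain μ X p a) {n : ℕ}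
    {t : Fin (n + 1) → ℝ≥0} (ht : Monotone t) {t' : ℝ≥0} (h : t (Fin.last n) ≤ t')
    (x : Fin (n + 1) → S) (c : S) :
    μ.real (pathEvent (n := n + 2) X (Fin.snoc t t') (Fin.snoc x c)) =
      μ.real (pathEvent X t x) * p (t' - t (Fin.last n)) (x (Fin.last n)) c := by
  have markov := hX.markov n t ht x (t' - t (Fin.last n)) c
  rwa [add_tsub_cancel_of_le h, ← pathEvent_snoc] at markov

theorem IsMarkovChain.hasSum_setIntegral_pathEvent [Countable S] (hX : IsMarkovChain μ X p a)
    {n : ℕ} (t : Fin n → ℝ≥0) (t' : ℝ≥0) (x : Fin n → S) {F : Ω → ℝ} (hF : Integrable F μ) :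
    HasSum (fun c => ∫ ω in pathEvent (n := n + 1) X (Fin.snoc t t') (Fin.snoc x c), F ω ∂μ)
      (∫ ω in pathEvent X t x, F ω ∂μ) := by
  have partition : pathEvent X t x = ⋃ c, {ω | (∀ i, X (t i) ω = x i) ∧ X t' ω = c} := by
    ext ω; simp [pathEvent]
  simp_rw [pathEvent_snoc, partition]
  exact hasSum_integral_iUnion
    (fun c => (hX.measurableSet_pathEvent t x).inter (hX.measurableSet t' c))
    (fun c d hcd => Set.disjoint_left.2 fun ω hc hd => hcd (hc.2.symm.trans hd.2))
    hF.integrableOn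

theorem IsMarkovChain.setIntegral_pathEvent_eq_of_step [Countable S]
    (hX : IsMarkovChain μ X p a) {n : ℕ} {t : Fin (n + 1) → ℝ≥0} (ht : Monotone t) {t' : ℝ≥0}
    (h : t (Fin.last n) ≤ t') (x : Fin (n + 1) → S) {F : Ω → ℝ} (hF : Integrable F μ)
    {g : S → ℝ} {G : ℝ}
    (hg : ∀ c, ∫ ω in pathEvent (n := n + 2) X (Fin.snoc t t') (Fin.snoc x c), F ω ∂μ =
      μ.real (pathEvent (n := n + 2) X (Fin.snoc t t') (Fin.snoc x c)) * g c)
    (hG : HasSum (fun c => p (t' - t (Fin.last n)) (x (Fin.last n)) c * g c) G) :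
    ∫ ω in pathEvent X t x, F ω ∂μ = μ.real (pathEvent X t x) * G := by
  refine (hX.hasSum_setIntegral_pathEvent t t' x hF).unique
    ((hG.mul_left (μ.real (pathEvent X t x))).congr_fun fun c => ?_)
  rw [hg, hX.measureReal_pathEvent_snoc ht h, mul_assoc]

end MarkovChain

section Correlations

variable {N : ℕ} {Ω ι : Type*} [Fintype ι] {X : ℝ≥0 → Ω → Weyl N}

/-- The event that the configuration `X t` contains the point `y`. -/
def occupied (X : ℝ≥0 → Ω → Weyl N) (t : ℝ≥0) (y : ℤ) : Set Ω :=
  {ω | ∃ j, (X t ω).1 j = y}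

theorem prod_one_add_indicator_occupied {τ : ι → ℝ≥0} (y : ι → ℤ) (u : ℝ) {s t : ℝ≥0}
    (hst : s < t) (hgap : ∀ α, s < τ α → t ≤ τ α) {ω : Ω} {c : Weyl N} (hω : X t ω = c) :
    ∏ α with s < τ α, (1 + u * (occupied X (τ α) (y α)).indicator 1 ω) =
      (∏ j, timeWeight τ y u t (c.1 j)) *
        ∏ α with t < τ α, (1 + u * (occupied X (τ α) (y α)).indicator 1 ω) := by
  classical
  rw [filter_lt_eq_union hst hgap, Finset.prod_union (disjoint_filter_lt_filter_eq τ t), mul_comm,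
    prod_timeWeight]
  congr 1
  refine Finset.prod_congr rfl fun β hβ => ?_
  simp only [Set.indicator_apply, occupied, Set.mem_ofPred_eq, (Finset.mem_filter.1 hβ).2, hω,
    Pi.one_apply]

theorem card_filter_lt_lt {T : Type*} [LinearOrder T] (τ : ι → T) {s : T} {α : ι} (h : s < τ α) :
    (Finset.univ.filter fun β => τ α < τ β).card < (Finset.univ.filter fun β => s < τ β).card := by
  refine Finset.card_lt_card
    ⟨Finset.monotone_filter_right _ fun β _ hβ => h.trans hβ, fun hsub => ?_⟩
  exact lt_irrefl _ (Finset.mem_filter.1 (hsub (Finset.mem_filter.2 ⟨Finset.mem_univ α, h⟩))).2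

variable [DecidableEq ι] [MeasurableSpace Ω] {μ : Measure Ω} {a : Weyl N} {τ : ι → ℝ≥0}
  {y : ι → ℤ}

theorem setIntegral_prod_one_add_indicator [IsFiniteMeasure μ]
    (hX : IsMarkovChain μ X (fun t : ℝ≥0 => kmTransition (t : ℝ)) a)
    (hinj : Function.Injective fun i => (τ i, y i)) (u : ℝ) {n : ℕ} {t : Fin (n + 1) → ℝ≥0}
    (ht : Monotone t) (x : Fin (n + 1) → Weyl N) :
    ∫ ω in pathEvent X t x, ∏ α with t (Fin.last n) < τ α,
        (1 + u * (occupied X (τ α) (y α)).indicator 1 ω) ∂μ =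
      μ.real (pathEvent X t x) * condWeight a τ y u (t (Fin.last n)) (x (Fin.last n)) := by
  induction hm : (Finset.univ.filter fun α => t (Fin.last n) < τ α).card
    using Nat.strong_induction_on generalizing n t x with
  | _ m ih =>
  rcases (Finset.univ.filter fun α => t (Fin.last n) < τ α).eq_empty_or_nonempty
    with no_later | some_later
  · rw [no_later, condWeight_eq_one a y u fun α =>
      Finset.filter_eq_empty_iff.1 no_later (Finset.mem_univ α)]
    simp
  obtain ⟨α₀, hα₀, first⟩ := Finset.exists_min_image _ τ some_later
  have hst : t (Fin.last n) < τ α₀ := (Finset.mem_filter.1 hα₀).2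
  have hgap : ∀ α, t (Fin.last n) < τ α → τ α₀ ≤ τ α := fun α hα =>
    first α (Finset.mem_filter.2 ⟨Finset.mem_univ α, hα⟩)
  have transition_sum := hasSum_kmTransition_mul_condWeight a hinj u hst hgap (x (Fin.last n))
  rw [← NNReal.coe_sub hst.le] at transition_sum
  refine hX.setIntegral_pathEvent_eq_of_step ht hst.le x
    (integrable_prod_one_add_indicator (fun α =>
      hX.measurableSet_mem (τ α) {x | ∃ j, x.1 j = y α}) u _) (fun c => ?_) transition_sum
  have later := ih _ (by rw [← hm, Fin.snoc_last]; exact card_filter_lt_lt τ hst)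
    (monotone_snoc ht hst.le) (Fin.snoc x c) rfl
  rw [Fin.snoc_last, Fin.snoc_last] at later
  rw [mul_left_comm, ← later, ← integral_const_mul]
  refine setIntegral_congr_fun (hX.measurableSet_pathEvent _ _) fun ω hω => ?_
  rw [pathEvent_snoc] at hω
  exact prod_one_add_indicator_occupied y u hst hgap hω.2

theorem integral_prod_one_add_indicator [IsProbabilityMeasure μ]
    (hX : IsMarkovChain μ X (fun t : ℝ≥0 => kmTransition (t : ℝ)) a) (hτ : ∀ i, 0 < τ i)
    (hinj : Function.Injective fun i => (τ i, y i)) (u : ℝ) :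
    ∫ ω, ∏ α, (1 + u * (occupied X (τ α) (y α)).indicator 1 ω) ∂μ =
      (1 + u • Matrix.of fun α β => biorthKernel a (τ α) (y α) (τ β) (y β)).det := by
  have start : pathEvent X (fun _ : Fin 1 => 0) (fun _ => a) =ᵐ[μ] Set.univ := by
    rw [eventuallyEq_univ]
    filter_upwards [hX.start] with ω hω using fun _ => hω
  have conditional := setIntegral_prod_one_add_indicator hX hinj u
    (t := fun _ : Fin 1 => 0) (fun _ _ _ => le_rfl) (fun _ => a)
  rwa [Finset.filter_true_of_mem fun β _ => hτ β, condWeight_zero a hτ,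
    setIntegral_congr_set start, setIntegral_univ, measureReal_congr start, probReal_univ,
    one_mul] at conditional

theorem measureReal_iInter_occupied [IsProbabilityMeasure μ]
    (hX : IsMarkovChain μ X (fun t : ℝ≥0 => kmTransition (t : ℝ)) a) (hτ : ∀ i, 0 < τ i)
    (hinj : Function.Injective fun i => (τ i, y i)) :
    μ.real (⋂ i, occupied X (τ i) (y i)) =
      (Matrix.of fun α β => biorthKernel a (τ α) (y α) (τ β) (y β)).det :=
  measureReal_iInter_eq_det (fun α => hX.measurableSet_mem (τ α) {x | ∃ j, x.1 j = y α})
    (integral_prod_one_add_indicator hX hτ hinj)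

theorem isDeterminantal_poissonKernel [IsProbabilityMeasure μ]
    (C : ∀ x₁ x₂ : ℤ, PoissonContour a x₁ x₂) (hX : IsNoncollidingPoissonWalk μ X a) :
    IsDeterminantal μ X (poissonKernel a C) := by
  obtain ⟨p, hp, hq, hX⟩ := hX
  obtain rfl : p = fun t : ℝ≥0 => kmTransition (t : ℝ) := by
    ext t x z; exact transition_eq_kmTransition hp hq t x z
  intro k τ y hτ hinj
  have occupied_all : {ω | ∀ i, ∃ j, (X (τ i) ω).1 j = y i} = ⋂ i, occupied X (τ i) (y i) :=
    Set.ofPred_forall _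
  rw [occupied_all, measureReal_iInter_occupied hX hτ hinj, ← Complex.ofRealHom_eq_coe,
    RingHom.map_det]
  congr 1
  ext α β
  exact (poissonKernel_eq_biorthKernel a C (NNReal.coe_pos.2 (hτ α))
    (NNReal.coe_pos.2 (hτ β)) _ _).symm

end Correlations

end NoncollidingWalk

open NoncollidingWalk in
theorem theoremA1 {N : ℕ} (a : Weyl N)
    (C : ∀ x₁ x₂ : ℤ, PoissonContour a x₁ x₂)
    (B : ∀ (t₁ : ℕ) (x₁ : ℤ) (t₂ : ℕ) (x₂ : ℤ), BernoulliContour a t₁ x₁ t₂ x₂) :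
    -- the outer integral in the kernel converges absolutely
    (∀ (x₁ x₂ : ℤ) (τ₁ τ₂ : ℝ), 0 < τ₁ → 0 < τ₂ →
      Complex.VerticalIntegrable (poissonInner a (C x₁ x₂) τ₁ τ₂) ((x₂ : ℝ) - 1 / 2)) ∧
    -- the noncolliding Poisson random walk started from `a` is determinantal
    (∀ (Ω : Type*) [MeasurableSpace Ω] (μ : Measure Ω) [IsProbabilityMeasure μ]
      (X : ℝ≥0 → Ω → Weyl N), IsNoncollidingPoissonWalk μ X a →
      IsDeterminantal μ X (poissonKernel a C)) ∧
    -- the kernel is the limit of the gauge transformed Bernoulli kernel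
    (∀ (x₁ x₂ : ℤ) (τ₁ τ₂ : ℝ), 0 < τ₁ → 0 < τ₂ →
      Tendsto
        (fun β : ℝ => (-(β : ℂ)) ^ (x₁ - x₂) *
          bernoulliKernel a B β ⌊τ₁ / β⌋₊ x₁ ⌊τ₂ / β⌋₊ x₂)
        (𝓝[>] 0) (𝓝 (poissonKernel a C τ₁ x₁ τ₂ x₂))) :=
  ⟨fun x₁ x₂ _ _ h₁ h₂ => verticalIntegrable_poissonInner a (C x₁ x₂) h₁ h₂,
    fun _ _ _ _ _ hX => isDeterminantal_poissonKernel C hX,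
    fun x₁ x₂ _ _ h₁ h₂ => tendsto_bernoulliKernel a C B x₁ x₂ h₁ h₂⟩
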